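/- All graphs are finite and simple. A \emph{trigraph} $H$ has a vertex set $V(H)$ and two disjoint sets $B(H)$ (black edges) and $R(H)$ (red edges) of unordered pairs of vertices; a graph is a trigraph without red edges, and the underlying graph of $H$ has edge set $B(H)\cup R(H)$. \emph{Contracting} two distinct vertices $u,v$ replaces them by a new vertex $x$, where for every other vertex $y$ the pair $xy$ is a black edge if $y$ is a black neighbour of both $u$ and $v$, a non-edge if $y$ is adjacent to neither, and a red edge otherwise. A \emph{$1$-contraction sequence} of a graph $G$ on $n$ vertices is a sequence of trigraphs $G_n=G,\dots,G_1$ in which $G_1$ has a single vertex, each $G_{i-1}$ is obtained from $G_i$ by contracting two vertices, and every vertex of every $G_i$ is incident to at most one red edge. A vertex $x$ of $G_i$ is identified with the set of vertices of $G$ that were contracted into it. A \emph{realiser} of $G$ is a pair $(\sigma,\tau)$ of linear orderings of $V(G)$ such that two vertices are adjacent in $G$ if and only if $\sigma$ and $\tau$ order them differently. A set is an \emph{interval} of an ordering if it consists of the elements at a set of successive positions, and two elements are \emph{consecutive} for a pair of orderings if they form an interval of at least one of the two. Choosing one vertex of $G$ in every vertex of $G_i$ in such a way that the chosen vertices induce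 in $G$ a copy of the underlying graph of $G_i$ (which is always possible for a $1$-contraction sequence), one obtains from $(\sigma,\tau)$ a pair of orderings $(\sigma[G_i],\tau[G_i])$ of $V(G_i)$. We say that a $1$-contraction sequence $G_n,\dots,G_1$ of $G$ \emph{follows} $(\sigma,\tau)$ if for every $1<i\le n$ such a choice exists and, for every such choice, the two vertices contracted from $G_i$ to $G_{i-1}$ are consecutive for $(\sigma[G_i],\tau[G_i])$, and so are the two endpoints of every red edge of $G_i$. \textbf{Statement.} Let $G$ be a graph and let $G_n,\dots,G_1$ be a $1$-contraction sequence of $G$. (1) There is a realiser $(\sigma,\tau)$ of $G$ such that for every $1\le i\le n$: (a) every $x\in V(G_i)$ is an interval of $\sigma$ or of $\tau$; (b) for every $xy\in R(G_i)$, the set $x\cup y$ is an interval of one of the orderings $\sigma,\tau$, and both $x$ and $y$ are intervals of the other one. Moreover, the sequence $G_n,\dots,G_1$ follows every realiser of $G$ with these properties. (2) Conversely, for every realiser $(\sigma',\tau')$ of $G$ there is a $1$-contraction sequence of $G$ that follows $(\sigma',\tau')$. -/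

import Mathlib

namespace TwinWidthOne

/-- A trigraph with vertices in `α`: a vertex set together with two disjoint sets of unordered
pairs of vertices, the black edges and the red edges. -/
@[ext]
structure Trigraph (α : Type*) where
  verts : Set α
  black : SimpleGraph α
  red : SimpleGraph α
  black_mem : ∀ {x y : α}, black.Adj x y → x ∈ verts
  red_mem : ∀ {x y : α}, red.Adj x y → x ∈ verts
  disjoint : Disjoint black red

namespace Trigraph

variable {α : Type*}

/-- The underlying graph: its edges are the black edges and the red edges. -/
def underlying (H : Trigraph α) : SimpleGraph α := H.black ⊔ H.red

/-- Every vertex has at most `d` red neighbours. -/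
def IsDTrigraph (H : Trigraph α) (d : ℕ) : Prop :=
  ∀ x ∈ H.verts, {y | H.red.Adj x y}.encard ≤ d

/-- The trigraph obtained from `H` by contracting `u` and `v` into a new vertex called `x`: the
vertices `u` and `v` are removed and `x` is added; `x` is joined to a remaining vertex `y` by a
black edge if `y` is a black neighbour of both `u` and `v`, by no edge if `y` is adjacent to neither
of them, and by a red edge otherwise. All other edges are kept with their colour.
(`x` is meant not to be a vertex of `H` other than `u` and `v`.) -/
def contract (H : Trigraph α) (u v x : α) : Trigraph α where
  verts := insert x (H.verts \ {u, v})
  black := SimpleGraph.fromRel fun y z =>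
    (y ∈ H.verts \ {u, v, x} ∧ z ∈ H.verts \ {u, v, x} ∧ H.black.Adj y z) ∨
    (y = x ∧ z ∈ H.verts \ {u, v, x} ∧ H.black.Adj u z ∧ H.black.Adj v z)
  red := SimpleGraph.fromRel fun y z =>
    (y ∈ H.verts \ {u, v, x} ∧ z ∈ H.verts \ {u, v, x} ∧ H.red.Adj y z) ∨
    (y = x ∧ z ∈ H.verts \ {u, v, x} ∧ (H.underlying.Adj u z ∨ H.underlying.Adj v z) ∧
      ¬ (H.black.Adj u z ∧ H.black.Adj v z))
  black_mem := by
    intro y z h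
    simp only [SimpleGraph.fromRel_adj, Set.mem_sdiff, Set.mem_insert_iff,
      Set.mem_singleton_iff] at h ⊢
    tauto
  red_mem := by
    intro y z h
    simp only [SimpleGraph.fromRel_adj, Set.mem_sdiff, Set.mem_insert_iff,
      Set.mem_singleton_iff] at h ⊢
    tauto
  disjoint := by
    rw [SimpleGraph.disjoint_left]
    intro y z h h'
    have hd : H.black.Adj y z → ¬ H.red.Adj y z := fun h₁ h₂ =>
      SimpleGraph.disjoint_left.1 H.disjoint _ _ h₁ h₂
    have e1 := H.red.adj_comm y z
    have e2 := H.black.adj_comm y z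
    simp only [SimpleGraph.fromRel_adj, Set.mem_sdiff, Set.mem_insert_iff,
      Set.mem_singleton_iff] at h h'
    obtain ⟨hne, (⟨⟨-, hy⟩, ⟨-, hz⟩, h⟩ | ⟨hy, ⟨-, hz⟩, h⟩) |
      (⟨⟨-, hz⟩, ⟨-, hy⟩, h⟩ | ⟨hz, ⟨-, hy⟩, h⟩)⟩ := h <;>
    obtain ⟨-, (⟨⟨-, hy'⟩, ⟨-, hz'⟩, h'⟩ | ⟨hy', ⟨-, hz'⟩, h'⟩) |
      (⟨⟨-, hz'⟩, ⟨-, hy'⟩, h'⟩ | ⟨hz', ⟨-, hy'⟩, h'⟩)⟩ := h' <;>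
    clear hne <;> tauto

end Trigraph

variable {V : Type*}

/-- A graph seen as a trigraph without red edges. The vertices of the trigraphs in a contraction
sequence of a graph on `V` are sets of elements of `V`, namely the sets of vertices contracted
together, so a vertex `a` of the graph is represented by `{a}`. -/
def ofGraph (G : SimpleGraph V) : Trigraph (Set V) where
  verts := Set.range fun a : V => ({a} : Set V)
  black := G.map fun a : V => ({a} : Set V)
  red := ⊥
  black_mem := by
    rintro x y h
    obtain ⟨-, a, b, -, rfl, -⟩ := h
    exact ⟨a, rfl⟩
  red_mem := by
    intro x y h
    exact absurd h (by simp)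
  disjoint := disjoint_bot_right

/-- `H'` is obtained from `H` by contracting its distinct vertices `u` and `v`; the new vertex is
the union of the sets `u` and `v`. -/
def IsContraction (H H' : Trigraph (Set V)) (u v : Set V) : Prop :=
  u ∈ H.verts ∧ v ∈ H.verts ∧ u ≠ v ∧ H' = H.contract u v (u ∪ v)

/-- The map `r`, which picks one vertex of `G` in every vertex of `H`, exhibits the underlying graph
of `H` as an induced subgraph of `G`. -/
def IsInducedCopy (G : SimpleGraph V) (H : Trigraph (Set V)) (r : Set V → V) : Prop :=
  (∀ x ∈ H.verts, r x ∈ x) ∧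
  ∀ x ∈ H.verts, ∀ y ∈ H.verts, H.underlying.Adj x y ↔ G.Adj (r x) (r y)

section

variable [Fintype V]

/-- `S n, …, S 1` (where `n` is the number of vertices of `G`) is a contraction sequence of `G` and
a `d`-sequence. The values of `S` at other indices play no role. -/
structure IsDSequence (G : SimpleGraph V) (d : ℕ) (S : ℕ → Trigraph (Set V)) : Prop where
  pos : 1 ≤ Fintype.card V
  start : S (Fintype.card V) = ofGraph G
  last : ∃ x, (S 1).verts = {x}
  step : ∀ i, 1 < i → i ≤ Fintype.card V → ∃ u v, IsContraction (S i) (S (i - 1)) u v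
  red_degree : ∀ i, 1 ≤ i → i ≤ Fintype.card V → (S i).IsDTrigraph d

/-- A linear ordering `V → [n]` of a set `V` with `n` elements. -/
abbrev Ordering (V : Type*) [Fintype V] := V ≃ Fin (Fintype.card V)

/-- The graph `G[σ, τ]`: two vertices are adjacent if and only if the two orderings order them
differently, i.e. their segments cross in the permutation diagram. -/
def permGraph (σ τ : Ordering V) : SimpleGraph V where
  Adj u v := (σ u < σ v ∧ τ v < τ u) ∨ (σ v < σ u ∧ τ u < τ v)
  symm := ⟨fun _ _ h => h.symm⟩
  loopless := ⟨fun u h => by simp at h⟩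

/-- `(σ, τ)` is a realiser of `G`. -/
def IsRealiser (G : SimpleGraph V) (σ τ : Ordering V) : Prop :=
  G = permGraph σ τ

/-- `I` is an interval of `V` for the ordering `σ`. -/
def IsInterval (σ : Ordering V) (I : Set V) : Prop :=
  ∃ i j : Fin (Fintype.card V), I = {w | i ≤ σ w ∧ σ w ≤ j}

/-- The two properties, with respect to the contraction sequence `S`, of the realiser that is
built from `S`. -/
structure IsAdapted (S : ℕ → Trigraph (Set V)) (σ τ : Ordering V) : Prop where
  /-- Every vertex of a trigraph of the sequence, as a set of vertices of the initial graph, is an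
  interval for one of the two orderings. -/
  vertex : ∀ i, 1 ≤ i → i ≤ Fintype.card V → ∀ x ∈ (S i).verts,
    IsInterval σ x ∨ IsInterval τ x
  /-- For every red edge `xy`, the set `x ∪ y` is an interval for one ordering, and both `x` and `y`
  are intervals for the other one. -/
  red : ∀ i, 1 ≤ i → i ≤ Fintype.card V → ∀ x y, (S i).red.Adj x y →
    (IsInterval σ (x ∪ y) ∧ IsInterval τ x ∧ IsInterval τ y) ∨
    (IsInterval τ (x ∪ y) ∧ IsInterval σ x ∧ IsInterval σ y)

/-- `I` is an interval for the ordering of the vertices of `H` induced by `σ`, where `H` is seen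
as an induced subgraph through `r`. (The positions are those in `σ`; renumbering them by
`1, 2, …` does not change the intervals.) -/
def IsInducedInterval (σ : Ordering V) (H : Trigraph (Set V)) (r : Set V → V)
    (I : Set (Set V)) : Prop :=
  ∃ i j : Fin (Fintype.card V), I = {w | w ∈ H.verts ∧ i ≤ σ (r w) ∧ σ (r w) ≤ j}

/-- `x` and `y` are consecutive for the pair of orderings of the vertices of `H` induced by
`(σ, τ)`, i.e. consecutive for at least one of the two. -/
def IsConsecutive (σ τ : Ordering V) (H : Trigraph (Set V)) (r : Set V → V)
    (x y : Set V) : Prop :=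
  IsInducedInterval σ H r {x, y} ∨ IsInducedInterval τ H r {x, y}

/-- The sequence `S` of trigraphs follows `(σ, τ)`: for every `i > 1`, `S i` can be seen as an
induced subgraph of `G` and, however this is done, the vertices contracted from `S i` to `S (i - 1)`
are consecutive for the orderings induced by `(σ, τ)`, and so are the endpoints of every red edge
of `S i`. -/
def Follows (G : SimpleGraph V) (S : ℕ → Trigraph (Set V)) (σ τ : Ordering V) : Prop :=
  ∀ i, 1 < i → i ≤ Fintype.card V →
    (∃ r, IsInducedCopy G (S i) r) ∧
    ∀ r, IsInducedCopy G (S i) r →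
      (∀ u v, IsContraction (S i) (S (i - 1)) u v → IsConsecutive σ τ (S i) r u v) ∧
      (∀ x y, (S i).red.Adj x y → IsConsecutive σ τ (S i) r x y)

end

end TwinWidthOne

/-! A trigraph in a contraction sequence of `G` is determined by its parts: two parts are joined in
black if they are completely adjacent and in red if they are mixed. A 1-contraction sequence is thus
a chain of merges from the singletons to `V` in which mixedness is a matching on every partition
(`contract_ofParts`, `isDTrigraph_ofParts`).

Existence of an adapted realiser. The components of a red matching are single parts and red edges.
Along the chain, every component keeps a realiser compatible with all parts and red edges met so
far; for a red edge `xy`, one of the two orderings lists `x` and then `y`. Merging `u` and `v` glues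
such realisers by concatenation, or by inserting one block between two others, and old blocks stay
contiguous. If `u ∪ v` acquires a red neighbour `y` that was mixed with neither `u` nor `v`, then
`y` is joined to exactly one of them, and its ordering fits between those of `u` and `v`. If `y` was
already mixed with `v`, then `u` was isolated in the red graph and is placed beside `v`
(`Realisable.merge`, `MergePath.exists_adapted`).

Following. Two contracted parts, or the ends of a red edge, have a union that is an interval of one
ordering, so no representative of a third part lies between theirs, whatever the choice of
representatives.

Every realiser. By induction on the vertex set, as in modular decomposition. A nontrivial common
interval `M` of the two orderings is contracted first and the quotient afterwards; both inherit
sequences from `G` by restriction (`exists_path_of_commonInterval`, `Contractible.mono`). Without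
such an `M`, the realiser is unique up to exchange and reversal (`FnRealises.convexIn_unique`), so
its intervals are those of the adapted realiser already built. Uniqueness follows from Gallai's
theorem: a 3-colouring of pairs without rainbow triangles has a disconnected colour
(`GallaiColoring.exists_cut`). -/

namespace TwinWidthOne

variable {V : Type*}

/-! ### Mixed pairs of sets; precedence in lists -/

/-- `x` and `y` are mixed: some edges and some non-edges join them. -/
def Mixed (G : SimpleGraph V) (x y : Set V) : Prop :=
  (∃ a ∈ x, ∃ b ∈ y, G.Adj a b) ∧ ∃ a ∈ x, ∃ b ∈ y, ¬ G.Adj a b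

theorem Mixed.symm {G : SimpleGraph V} {x y : Set V} (h : Mixed G x y) : Mixed G y x := by
  obtain ⟨⟨a, ha, b, hb, h1⟩, c, hc, d, hd, h2⟩ := h
  exact ⟨⟨b, hb, a, ha, h1.symm⟩, d, hd, c, hc, fun h => h2 h.symm⟩

theorem Mixed.mono {G : SimpleGraph V} {x y x' y' : Set V} (h : Mixed G x y)
    (hx : x ⊆ x') (hy : y ⊆ y') : Mixed G x' y' := by
  obtain ⟨⟨a, ha, b, hb, h1⟩, c, hc, d, hd, h2⟩ := h
  exact ⟨⟨a, hx ha, b, hy hb, h1⟩, c, hx hc, d, hy hd, h2⟩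

theorem not_mixed_iff {G : SimpleGraph V} {x y : Set V} :
    ¬ Mixed G x y ↔ (∀ a ∈ x, ∀ b ∈ y, G.Adj a b) ∨ ∀ a ∈ x, ∀ b ∈ y, ¬ G.Adj a b := by
  unfold Mixed
  push Not
  constructor
  · intro h
    by_cases h' : ∃ a ∈ x, ∃ b ∈ y, G.Adj a b
    · exact Or.inl (h h')
    · push Not at h'
      exact Or.inr h'
  · rintro (h | h) ⟨a, ha, b, hb, h'⟩
    · exact h
    · exact absurd h' (h a ha b hb)

/-- `a` occurs before `b` in the list `l`. -/
abbrev Before (l : List V) (a b : V) : Prop := [a, b].Sublist l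

theorem before_cons {l : List V} {a b c : V} :
    Before (c :: l) a b ↔ (a = c ∧ b ∈ l) ∨ Before l a b := by
  unfold Before
  rw [List.cons_sublist_cons']
  simp [or_comm]

theorem Before.left_mem {l : List V} {a b : V} (h : Before l a b) : a ∈ l := h.subset (by simp)

theorem Before.right_mem {l : List V} {a b : V} (h : Before l a b) : b ∈ l := h.subset (by simp)

theorem before_append {l m : List V} {a b : V} :
    Before (l ++ m) a b ↔ Before l a b ∨ (a ∈ l ∧ b ∈ m) ∨ Before m a b := by
  induction l with
  | nil => simp [Before]
  | cons c l ih =>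
    rw [List.cons_append, before_cons, ih, before_cons]
    simp only [List.mem_append, List.mem_cons]
    constructor
    · rintro (⟨rfl, h | h⟩ | h | ⟨h, h'⟩ | h) <;> simp_all
    · rintro ((⟨rfl, h⟩ | h) | ⟨rfl | h, h'⟩ | h) <;> simp_all

theorem before_reverse {l : List V} {a b : V} : Before l.reverse a b ↔ Before l b a := by
  unfold Before
  rw [← List.reverse_sublist]
  simp

theorem before_total {l : List V} {a b : V} (ha : a ∈ l) (hb : b ∈ l) (hab : a ≠ b) :
    Before l a b ∨ Before l b a := by
  induction l with
  | nil => simp at ha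
  | cons c l ih =>
    rw [before_cons, before_cons]
    simp only [List.mem_cons] at ha hb
    rcases ha with rfl | ha <;> rcases hb with rfl | hb
    · exact absurd rfl hab
    · simp [hb]
    · simp [ha]
    · rcases ih ha hb with h | h <;> simp [h]

theorem Before.asymm {l : List V} {a b : V} (hl : l.Nodup) (h : Before l a b) :
    ¬ Before l b a := by
  intro h'
  induction l with
  | nil => simp [Before] at h
  | cons c l ih =>
    rw [List.nodup_cons] at hl
    rw [before_cons] at h h'
    rcases h with ⟨rfl, h⟩ | h
    · rcases h' with ⟨rfl, h'⟩ | h'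
      · exact hl.1 h
      · exact hl.1 h'.right_mem
    · rcases h' with ⟨rfl, h'⟩ | h'
      · exact hl.1 h.right_mem
      · exact ih hl.2 h h'

theorem Before.ne {l : List V} {a b : V} (hl : l.Nodup) (h : Before l a b) : a ≠ b := by
  rintro rfl
  exact h.asymm hl h

/-- The elements of `z` form an infix of the list `l`. -/
def IsFactor (l : List V) (z : Set V) : Prop := ∃ m, m <:+: l ∧ {a | a ∈ m} = z

theorem IsFactor.mono {l m : List V} {z : Set V} (h : IsFactor l z) (hl : l <:+: m) :
    IsFactor m z := by
  obtain ⟨k, hk, rfl⟩ := h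
  exact ⟨k, hk.trans hl, rfl⟩

theorem IsFactor.reverse {l : List V} {z : Set V} (h : IsFactor l z) : IsFactor l.reverse z := by
  obtain ⟨k, hk, rfl⟩ := h
  exact ⟨k.reverse, List.reverse_infix.2 hk, by simp⟩

theorem isFactor_self {l : List V} {z : Set V} (h : {a | a ∈ l} = z) : IsFactor l z :=
  ⟨l, List.infix_refl l, h⟩

/-! ### Gluing realisers given by lists -/

/-- The lists `s` and `t` realise the subgraph of `G` induced on their common elements. -/
structure ListRealises (G : SimpleGraph V) (s t : List V) : Prop where
  nodup : s.Nodup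
  perm : s.Perm t
  adj_iff : ∀ a b, Before s a b → (G.Adj a b ↔ Before t b a)

theorem ListRealises.nodup_right {G : SimpleGraph V} {s t : List V} (h : ListRealises G s t) :
    t.Nodup := h.perm.nodup_iff.1 h.nodup

theorem ListRealises.symm {G : SimpleGraph V} {s t : List V} (h : ListRealises G s t) :
    ListRealises G t s := by
  refine ⟨h.nodup_right, h.perm.symm, fun a b hab => ?_⟩
  have ha := h.perm.mem_iff.2 hab.left_mem
  have hb := h.perm.mem_iff.2 hab.right_mem
  rcases before_total ha hb (hab.ne h.nodup_right) with h1 | h1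
  · have h2 := h.adj_iff _ _ h1
    have h3 := h1.asymm h.nodup
    have h4 := hab.asymm h.nodup_right
    tauto
  · have h2 := h.adj_iff _ _ h1
    rw [G.adj_comm] at h2
    tauto

theorem ListRealises.reverse {G : SimpleGraph V} {s t : List V} (h : ListRealises G s t) :
    ListRealises G s.reverse t.reverse := by
  refine ⟨List.nodup_reverse.2 h.nodup,
    (List.reverse_perm s).trans (h.perm.trans (List.reverse_perm t).symm), fun a b hab => ?_⟩
  rw [before_reverse] at hab ⊢
  rw [G.adj_comm]
  exact h.adj_iff _ _ hab

/-- Juxtaposition of two realisers, without edges between the two parts. -/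
theorem ListRealises.append {G : SimpleGraph V} {s t s' t' : List V} (h : ListRealises G s t)
    (h' : ListRealises G s' t') (hd : ∀ a ∈ s, a ∉ s')
    (hn : ∀ a ∈ s, ∀ b ∈ s', ¬ G.Adj a b) : ListRealises G (s ++ s') (t ++ t') := by
  have e : ∀ a, a ∈ t ↔ a ∈ s := fun a => h.perm.mem_iff.symm
  have e' : ∀ a, a ∈ t' ↔ a ∈ s' := fun a => h'.perm.mem_iff.symm
  refine ⟨List.nodup_append'.2 ⟨h.nodup, h'.nodup, fun a ha hb => hd a ha hb⟩,
    h.perm.append h'.perm, fun a b hab => ?_⟩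
  rw [before_append] at hab ⊢
  have m1 : ∀ {a b}, Before t a b → a ∈ s ∧ b ∈ s := fun h =>
    ⟨(e _).1 h.left_mem, (e _).1 h.right_mem⟩
  have m2 : ∀ {a b}, Before t' a b → a ∈ s' ∧ b ∈ s' := fun h =>
    ⟨(e' _).1 h.left_mem, (e' _).1 h.right_mem⟩
  rw [e, e']
  rcases hab with hab | ⟨ha, hb⟩ | hab
  · have := h.adj_iff _ _ hab
    have := hd _ hab.left_mem
    have := hd _ hab.right_mem
    have := @m2 b a
    tauto
  · have := hn a ha b hb
    have := hd _ ha
    have := @m1 b a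
    have := @m2 b a
    have := hd b
    tauto
  · have := h'.adj_iff _ _ hab
    have := fun h => hd a h hab.left_mem
    have := fun h => hd b h hab.right_mem
    have := @m1 b a
    tauto

/-- Juxtaposition of two realisers, with all edges between the two parts. -/
theorem ListRealises.append_swap {G : SimpleGraph V} {s t s' t' : List V}
    (h : ListRealises G s t) (h' : ListRealises G s' t') (hd : ∀ a ∈ s, a ∉ s')
    (hn : ∀ a ∈ s, ∀ b ∈ s', G.Adj a b) : ListRealises G (s ++ s') (t' ++ t) := by
  have e : ∀ a, a ∈ t ↔ a ∈ s := fun a => h.perm.mem_iff.symm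
  have e' : ∀ a, a ∈ t' ↔ a ∈ s' := fun a => h'.perm.mem_iff.symm
  refine ⟨List.nodup_append'.2 ⟨h.nodup, h'.nodup, fun a ha hb => hd a ha hb⟩,
    (h.perm.append h'.perm).trans List.perm_append_comm, fun a b hab => ?_⟩
  rw [before_append] at hab ⊢
  have m1 : ∀ {a b}, Before t a b → a ∈ s ∧ b ∈ s := fun h =>
    ⟨(e _).1 h.left_mem, (e _).1 h.right_mem⟩
  have m2 : ∀ {a b}, Before t' a b → a ∈ s' ∧ b ∈ s' := fun h =>
    ⟨(e' _).1 h.left_mem, (e' _).1 h.right_mem⟩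
  rw [e, e']
  rcases hab with hab | ⟨ha, hb⟩ | hab
  · have := h.adj_iff _ _ hab
    have := hd _ hab.left_mem
    have := hd _ hab.right_mem
    have := @m2 b a
    tauto
  · have := hn a ha b hb
    tauto
  · have := h'.adj_iff _ _ hab
    have := fun h => hd a h hab.left_mem
    have := fun h => hd b h hab.right_mem
    have := @m1 b a
    tauto

/-- Insertion of a realiser between two parts: `t'` is joined to `q` but not to `p`. -/
theorem ListRealises.insert_right {G : SimpleGraph V} {s p q s' t' : List V}
    (h : ListRealises G s (p ++ q)) (h' : ListRealises G s' t') (hd : ∀ a ∈ s, a ∉ s')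
    (hp : ∀ a ∈ p, ∀ b ∈ s', ¬ G.Adj a b) (hq : ∀ a ∈ q, ∀ b ∈ s', G.Adj a b) :
    ListRealises G (s ++ s') (p ++ t' ++ q) := by
  have e : ∀ a, a ∈ s ↔ a ∈ p ∨ a ∈ q := fun a => by rw [h.perm.mem_iff, List.mem_append]
  have e' : ∀ a, a ∈ t' ↔ a ∈ s' := fun a => h'.perm.mem_iff.symm
  have hpq : ∀ a ∈ p, a ∉ q := fun a ha hb =>
    (List.nodup_append'.1 h.nodup_right).2.2 ha hb
  refine ⟨List.nodup_append'.2 ⟨h.nodup, h'.nodup, fun a ha hb => hd a ha hb⟩,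
    (h.perm.append h'.perm).trans ?_, fun a b hab => ?_⟩
  · rw [List.append_assoc, List.append_assoc]
    exact List.Perm.append_left p List.perm_append_comm
  rw [before_append] at hab
  simp only [before_append, List.mem_append]
  have m1 : ∀ {a b}, Before p a b → a ∈ p ∧ b ∈ p := fun h => ⟨h.left_mem, h.right_mem⟩
  have m2 : ∀ {a b}, Before q a b → a ∈ q ∧ b ∈ q := fun h => ⟨h.left_mem, h.right_mem⟩
  have m3 : ∀ {a b}, Before t' a b → a ∈ s' ∧ b ∈ s' := fun h =>
    ⟨(e' _).1 h.left_mem, (e' _).1 h.right_mem⟩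
  rw [e', e']
  simp only [e] at hd
  rcases hab with hab | ⟨ha, hb⟩ | hab
  · have h1 := h.adj_iff _ _ hab
    rw [before_append] at h1
    have := hd _ ((e _).1 hab.left_mem)
    have := hd _ ((e _).1 hab.right_mem)
    have := @m3 b a
    tauto
  · rw [e] at ha
    have := hd _ ha
    have := @m1 b a
    have := @m2 b a
    have := @m3 b a
    have := hd b
    have := hpq a
    rcases ha with ha | ha
    · have := hp a ha b hb
      tauto
    · have := hq a ha b hb
      tauto
  · have := h'.adj_iff _ _ hab
    have := fun h => hd a h hab.left_mem
    have := fun h => hd b h hab.right_mem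
    have := @m1 b a
    have := @m2 b a
    tauto

/-- Insertion of a realiser between two parts: `t'` is joined to `p` but not to `q`. -/
theorem ListRealises.insert_left {G : SimpleGraph V} {s p q s' t' : List V}
    (h : ListRealises G s (p ++ q)) (h' : ListRealises G s' t') (hd : ∀ a ∈ s, a ∉ s')
    (hp : ∀ a ∈ p, ∀ b ∈ s', G.Adj a b) (hq : ∀ a ∈ q, ∀ b ∈ s', ¬ G.Adj a b) :
    ListRealises G (s' ++ s) (p ++ t' ++ q) := by
  have h1 := h.reverse
  rw [List.reverse_append] at h1
  have h2 := (h1.insert_right h'.reverse (by simpa using hd) (by simpa using hq)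
    (by simpa using hp)).reverse
  simpa using h2

/-! ### Adapted realisers of one component of the red graph -/

section Adapted

variable (HV : Set V → Prop) (HR : Set V → Set V → Prop)

/-- The pair of lists `(s, p)` is adapted to the recorded sets and red pairs included in `x`. -/
def Admits (s p : List V) (x : Set V) : Prop :=
  (∀ z, HV z → z ⊆ x → IsFactor s z ∨ IsFactor p z) ∧
  ∀ z z', HR z z' → z ⊆ x → z' ⊆ x →
    (IsFactor s (z ∪ z') ∧ IsFactor p z ∧ IsFactor p z') ∨
    (IsFactor p (z ∪ z') ∧ IsFactor s z ∧ IsFactor s z')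

/-- The graph induced on `x` has a realiser adapted to the recorded sets and red pairs. -/
def SetRealisable (G : SimpleGraph V) (x : Set V) : Prop :=
  ∃ s t, ListRealises G s t ∧ {a | a ∈ s} = x ∧ Admits HV HR s t x

/-- The graph induced on `x ∪ y` has an adapted realiser, one ordering of which
is the concatenation of an ordering of `x` and one of `y`. -/
def PairRealisable (G : SimpleGraph V) (x y : Set V) : Prop :=
  ∃ s p q, ListRealises G s (p ++ q) ∧ {a | a ∈ p} = x ∧ {a | a ∈ q} = y ∧
    Admits HV HR s p x ∧ Admits HV HR s q y ∧
    ∀ z z', HR z z' → z ⊆ x → z' ⊆ y → IsFactor s (z ∪ z') ∧ IsFactor p z ∧ IsFactor q z'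

variable {HV HR}

theorem Admits.mono {s p s' p' : List V} {x : Set V} (h : Admits HV HR s p x)
    (hs : s <:+: s') (hp : p <:+: p') : Admits HV HR s' p' x := by
  refine ⟨fun z hz hx => (h.1 z hz hx).imp (·.mono hs) (·.mono hp), fun z z' hz hx hx' => ?_⟩
  exact (h.2 z z' hz hx hx').imp (fun k => ⟨k.1.mono hs, k.2.1.mono hp, k.2.2.mono hp⟩)
    fun k => ⟨k.1.mono hp, k.2.1.mono hs, k.2.2.mono hs⟩

theorem Admits.symm {s p : List V} {x : Set V} (h : Admits HV HR s p x) :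
    Admits HV HR p s x :=
  ⟨fun z hz hx => (h.1 z hz hx).symm, fun z z' hz hx hx' => (h.2 z z' hz hx hx').symm⟩

theorem Admits.reverse {s p : List V} {x : Set V} (h : Admits HV HR s p x) :
    Admits HV HR s.reverse p.reverse x := by
  refine ⟨fun z hz hx => (h.1 z hz hx).imp (·.reverse) (·.reverse), fun z z' hz hx hx' => ?_⟩
  exact (h.2 z z' hz hx hx').imp (fun k => ⟨k.1.reverse, k.2.1.reverse, k.2.2.reverse⟩)
    fun k => ⟨k.1.reverse, k.2.1.reverse, k.2.2.reverse⟩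

theorem Admits.union {s p : List V} {u v : Set V} (hu : Admits HV HR s p u)
    (hv : Admits HV HR s p v) (hsymm : ∀ z z', HR z z' → HR z' z)
    (hV : ∀ z, HV z → z ⊆ u ∪ v → z ⊆ u ∨ z ⊆ v)
    (hR : ∀ z z', HR z z' → HV z ∧ HV z')
    (hc : ∀ z z', HR z z' → z ⊆ u → z' ⊆ v →
      (IsFactor s (z ∪ z') ∧ IsFactor p z ∧ IsFactor p z') ∨
      (IsFactor p (z ∪ z') ∧ IsFactor s z ∧ IsFactor s z')) :
    Admits HV HR s p (u ∪ v) := by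
  refine ⟨fun z hz hx => (hV z hz hx).elim (hu.1 z hz) (hv.1 z hz), fun z z' hz hx hx' => ?_⟩
  rcases hV z (hR _ _ hz).1 hx with h | h <;> rcases hV z' (hR _ _ hz).2 hx' with h' | h'
  · exact hu.2 z z' hz h h'
  · exact hc z z' hz h h'
  · have := hc z' z (hsymm _ _ hz) h' h
    rw [Set.union_comm]
    tauto
  · exact hv.2 z z' hz h h'

/-- Recording a new partition adds nothing inside one of its members `x` except `x` itself, because
distinct parts are disjoint. -/
theorem Admits.extend {HV' : Set V → Prop} {HR' : Set V → Set V → Prop} {s p : List V}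
    {x : Set V} (h : Admits HV HR s p x) (hx : IsFactor s x ∨ IsFactor p x)
    (hV : ∀ z, HV' z → z ⊆ x → HV z ∨ z = x)
    (hR : ∀ z z', HR' z z' → z ⊆ x → z' ⊆ x → HR z z') : Admits HV' HR' s p x := by
  refine ⟨fun z hz hzx => ?_, fun z z' hz h1 h2 => h.2 z z' (hR z z' hz h1 h2) h1 h2⟩
  rcases hV z hz hzx with h' | rfl
  · exact h.1 z h' hzx
  · exact hx

theorem SetRealisable.extend {HV' : Set V → Prop} {HR' : Set V → Set V → Prop}
    {G : SimpleGraph V} {x : Set V} (h : SetRealisable HV HR G x)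
    (hV : ∀ z, HV' z → z ⊆ x → HV z ∨ z = x)
    (hR : ∀ z z', HR' z z' → z ⊆ x → z' ⊆ x → HR z z') : SetRealisable HV' HR' G x := by
  obtain ⟨s, t, h1, h2, h3⟩ := h
  exact ⟨s, t, h1, h2, h3.extend (Or.inl (isFactor_self h2)) hV hR⟩

theorem PairRealisable.mem {G : SimpleGraph V} {s p q : List V} {x y : Set V}
    (h : ListRealises G s (p ++ q)) (hp : {a | a ∈ p} = x) (hq : {a | a ∈ q} = y) :
    {a | a ∈ s} = x ∪ y := by
  subst hp hq
  ext a
  simp [h.perm.mem_iff]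

theorem PairRealisable.extend {HV' : Set V → Prop} {HR' : Set V → Set V → Prop}
    {G : SimpleGraph V} {x y : Set V} (h : PairRealisable HV HR G x y)
    (hV : ∀ z, HV' z → z ⊆ x → HV z ∨ z = x) (hV' : ∀ z, HV' z → z ⊆ y → HV z ∨ z = y)
    (hR : ∀ z z', HR' z z' → z ⊆ x → z' ⊆ x → HR z z')
    (hR' : ∀ z z', HR' z z' → z ⊆ y → z' ⊆ y → HR z z')
    (hc : ∀ z z', HR' z z' → z ⊆ x → z' ⊆ y → HR z z' ∨ (z = x ∧ z' = y)) :
    PairRealisable HV' HR' G x y := by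
  obtain ⟨s, p, q, h1, h2, h3, h4, h5, h6⟩ := h
  refine ⟨s, p, q, h1, h2, h3, h4.extend (Or.inr (isFactor_self h2)) hV hR,
    h5.extend (Or.inr (isFactor_self h3)) hV' hR', fun z z' hz hx hy => ?_⟩
  rcases hc z z' hz hx hy with h | ⟨rfl, rfl⟩
  · exact h6 z z' h hx hy
  · exact ⟨isFactor_self (PairRealisable.mem h1 h2 h3), isFactor_self h2, isFactor_self h3⟩

theorem PairRealisable.symm {G : SimpleGraph V} {x y : Set V} (h : PairRealisable HV HR G x y)
    (hsymm : ∀ z z', HR z z' → HR z' z) : PairRealisable HV HR G y x := by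
  obtain ⟨s, p, q, h1, h2, h3, h4, h5, h6⟩ := h
  refine ⟨s.reverse, q.reverse, p.reverse, ?_, by simpa using h3, by simpa using h2,
    h5.reverse, h4.reverse, fun z z' hz hx hy => ?_⟩
  · simpa using h1.reverse
  · have := h6 z' z (hsymm _ _ hz) hy hx
    rw [Set.union_comm]
    exact ⟨this.1.reverse, this.2.2.reverse, this.2.1.reverse⟩

/-- Sets that are not mixed are completely joined or not joined at all. The second ordering is the
juxtaposition of those of `u` and `v`; placing `u` after or before `v` in the first one creates all
edges or none. No recorded red pair can cross, since it would make `u` and `v` mixed. -/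
theorem SetRealisable.pair {G : SimpleGraph V} {u v : Set V} (hu : SetRealisable HV HR G u)
    (hv : SetRealisable HV HR G v) (hd : Disjoint u v) (hm : ¬ Mixed G u v)
    (hR : ∀ z z', HR z z' → Mixed G z z') : PairRealisable HV HR G u v := by
  obtain ⟨s, t, h1, rfl, h3⟩ := hu
  obtain ⟨s', t', h1', rfl, h3'⟩ := hv
  have hd' : ∀ a ∈ s, a ∉ s' := fun a ha ha' => Set.disjoint_left.1 hd ha ha'
  have e : {a | a ∈ t} = {a | a ∈ s} := by ext a; simp [h1.perm.mem_iff]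
  have e' : {a | a ∈ t'} = {a | a ∈ s'} := by ext a; simp [h1'.perm.mem_iff]
  have hc : ∀ z z', HR z z' → z ⊆ {a | a ∈ s} → z' ⊆ {a | a ∈ s'} → False :=
    fun z z' hz hx hy => hm ((hR z z' hz).mono hx hy)
  rcases not_mixed_iff.1 hm with h | h
  · refine ⟨s' ++ s, t, t', (h1'.append_swap h1 (fun a ha ha' => hd' a ha' ha)
      fun a ha b hb => (h b hb a ha).symm), e, e', ?_, ?_, fun z z' hz hx hy => (hc z z' hz hx hy).elim⟩
    · exact h3.mono (List.suffix_append _ _).isInfix (List.infix_refl _)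
    · exact h3'.mono (List.prefix_append _ _).isInfix (List.infix_refl _)
  · refine ⟨s ++ s', t, t', h1.append h1' hd' h, e, e', ?_, ?_,
      fun z z' hz hx hy => (hc z z' hz hx hy).elim⟩
    · exact h3.mono (List.prefix_append _ _).isInfix (List.infix_refl _)
    · exact h3'.mono (List.suffix_append _ _).isInfix (List.infix_refl _)

theorem PairRealisable.union {G : SimpleGraph V} {u v : Set V} (h : PairRealisable HV HR G u v)
    (hsymm : ∀ z z', HR z z' → HR z' z)
    (hV : ∀ z, HV z → z ⊆ u ∪ v → z ⊆ u ∨ z ⊆ v)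
    (hR : ∀ z z', HR z z' → HV z ∧ HV z') : SetRealisable HV HR G (u ∪ v) := by
  obtain ⟨s, p, q, h1, h2, h3, h4, h5, h6⟩ := h
  have hp : p <:+: p ++ q := (List.prefix_append _ _).isInfix
  have hq : q <:+: p ++ q := (List.suffix_append _ _).isInfix
  refine ⟨s, p ++ q, h1, PairRealisable.mem h1 h2 h3, (h4.mono (List.infix_refl _) hp).union
    (h5.mono (List.infix_refl _) hq) hsymm hV hR fun z z' hz hx hy => Or.inl ?_⟩
  have := h6 z z' hz hx hy
  exact ⟨this.1, this.2.1.mono hp, this.2.2.mono hq⟩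

/-- This is how a new red edge arises. Since `y` sees all of `u` and nothing of `v`, it can be
inserted exactly at the cut of the ordering `p ++ q`. The two orderings then exchange roles: the
former unsplit one, with `y` put in front, is the one split between `y` and `u ∪ v`. -/
theorem PairRealisable.union_pair {G : SimpleGraph V} {u v y : Set V}
    (h : PairRealisable HV HR G u v) (hy : SetRealisable HV HR G y)
    (hsymm : ∀ z z', HR z z' → HR z' z)
    (hV : ∀ z, HV z → z ⊆ u ∪ v → z ⊆ u ∨ z ⊆ v)
    (hR : ∀ z z', HR z z' → HV z ∧ HV z')
    (hRM : ∀ z z', HR z z' → Mixed G z z')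
    (huy : Disjoint u y) (hvy : Disjoint v y)
    (hu : ∀ a ∈ u, ∀ b ∈ y, G.Adj a b) (hv : ∀ a ∈ v, ∀ b ∈ y, ¬ G.Adj a b) :
    PairRealisable HV HR G (u ∪ v) y := by
  obtain ⟨s, p, q, h1, h2, h3, h4, h5, h6⟩ := h
  obtain ⟨s', t', h1', h2', h3'⟩ := hy
  have hs := PairRealisable.mem h1 h2 h3
  have es : ∀ a, a ∈ s ↔ a ∈ u ∪ v := fun a => by rw [← hs]; rfl
  have ep : ∀ a, a ∈ p ↔ a ∈ u := fun a => by rw [← h2]; rfl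
  have eq : ∀ a, a ∈ q ↔ a ∈ v := fun a => by rw [← h3]; rfl
  have es' : ∀ a, a ∈ s' ↔ a ∈ y := fun a => by rw [← h2']; rfl
  have hr : ListRealises G (p ++ t' ++ q) (s' ++ s) := by
    refine (h1.insert_left h1' ?_ ?_ ?_).symm
    · intro a ha ha'
      rw [es] at ha
      rw [es'] at ha'
      rcases ha with ha | ha
      · exact Set.disjoint_left.1 huy ha ha'
      · exact Set.disjoint_left.1 hvy ha ha'
    · intro a ha b hb
      exact hu a ((ep a).1 ha) b ((es' b).1 hb)
    · intro a ha b hb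
      exact hv a ((eq a).1 ha) b ((es' b).1 hb)
  have ip : p <:+: p ++ t' ++ q := ⟨[], t' ++ q, by simp⟩
  have iq : q <:+: p ++ t' ++ q := ⟨p ++ t', [], by simp⟩
  have it : t' <:+: p ++ t' ++ q := ⟨p, q, by simp⟩
  refine PairRealisable.symm ⟨p ++ t' ++ q, s', s, hr, h2', hs, h3'.symm.mono it (List.infix_refl _),
    ?_, fun z z' hz hx hx' => ?_⟩ hsymm
  · refine (h4.symm.mono ip (List.infix_refl _)).union (h5.symm.mono iq (List.infix_refl _))
      hsymm hV hR fun z z' hz hx hx' => Or.inr ?_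
    have := h6 z z' hz hx hx'
    exact ⟨this.1, this.2.1.mono ip, this.2.2.mono iq⟩
  · exfalso
    have hm := hRM z z' hz
    rcases hV z' (hR z z' hz).2 hx' with h | h
    · exact not_mixed_iff.2 (Or.inl hu) (hm.mono hx h).symm
    · exact not_mixed_iff.2 (Or.inr hv) (hm.mono hx h).symm

/-- The red edge `vy` survives as a red edge of `u ∪ v` and `y`. As `u` is homogeneous to both, it
goes next to `v` in the split ordering and at one end of the other one. The two sides available in
each ordering provide the four adjacency patterns. -/
theorem SetRealisable.union_pair {G : SimpleGraph V} {u v y : Set V}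
    (hu : SetRealisable HV HR G u) (h : PairRealisable HV HR G v y)
    (hsymm : ∀ z z', HR z z' → HR z' z)
    (hV : ∀ z, HV z → z ⊆ u ∪ v → z ⊆ u ∨ z ⊆ v)
    (hR : ∀ z z', HR z z' → HV z ∧ HV z')
    (hRM : ∀ z z', HR z z' → Mixed G z z')
    (huv : Disjoint u v) (huy : Disjoint u y)
    (hmv : ¬ Mixed G u v) (hmy : ¬ Mixed G u y) :
    PairRealisable HV HR G (u ∪ v) y := by
  obtain ⟨s', t', h1', h2', h3'⟩ := hu
  obtain ⟨s, p, q, h1, h2, h3, h4, h5, h6⟩ := h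
  have hs := PairRealisable.mem h1 h2 h3
  have es : ∀ a, a ∈ s ↔ a ∈ v ∪ y := fun a => by rw [← hs]; rfl
  have ep : ∀ a, a ∈ p ↔ a ∈ v := fun a => by rw [← h2]; rfl
  have eq : ∀ a, a ∈ q ↔ a ∈ y := fun a => by rw [← h3]; rfl
  have es' : ∀ a, a ∈ s' ↔ a ∈ u := fun a => by rw [← h2']; rfl
  have et' : ∀ a, a ∈ t' ↔ a ∈ u := fun a => by rw [← h1'.perm.mem_iff, es']
  have hd : ∀ a ∈ s, a ∉ s' := by
    intro a ha ha'
    rw [es] at ha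
    rw [es'] at ha'
    rcases ha with ha | ha
    · exact Set.disjoint_left.1 huv ha' ha
    · exact Set.disjoint_left.1 huy ha' ha
  have hd' : ∀ a ∈ s', a ∉ s := fun a ha ha' => hd a ha' ha
  -- Only the position of the block of `u` depends on the adjacency pattern; compatibility needs no
  -- more than that all old lists are infixes of the new ones.
  suffices ∃ l r, s <:+: l ∧ s' <:+: l ∧ p <:+: r ∧ t' <:+: r ∧ (∀ a, a ∈ r ↔ a ∈ u ∪ v) ∧
      ListRealises G l (r ++ q) by
    obtain ⟨l, r, i1, i2, i3, i4, i5, i6⟩ := this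
    refine ⟨l, r, q, i6, Set.ext i5, h3, ?_, h5.mono i1 (List.infix_refl _),
      fun z z' hz hx hy => ?_⟩
    · refine (h3'.mono i2 i4).union (h4.mono i1 i3) hsymm hV hR fun z z' hz hx hx' => ?_
      exact (hmv ((hRM z z' hz).mono hx hx')).elim
    · rcases hV z (hR z z' hz).1 hx with h | h
      · exact (hmy ((hRM z z' hz).mono h hy)).elim
      · have := h6 z z' hz h hy
        exact ⟨this.1.mono i1, this.2.1.mono i3, this.2.2⟩
  have j1 : ∀ l m : List V, l <:+: l ++ m := fun l m => (List.prefix_append _ _).isInfix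
  have j2 : ∀ l m : List V, m <:+: l ++ m := fun l m => (List.suffix_append _ _).isInfix
  have k1 : ∀ a, a ∈ t' ++ p ↔ a ∈ u ∪ v := fun a => by
    rw [List.mem_append, et', ep]; rfl
  have k2 : ∀ a, a ∈ p ++ t' ↔ a ∈ u ∪ v := fun a => by
    rw [List.mem_append, et', ep, or_comm]; rfl
  rcases not_mixed_iff.1 hmv with hv | hv <;> rcases not_mixed_iff.1 hmy with hy | hy
  · refine ⟨s ++ s', t' ++ p, j1 _ _, j2 _ _, j2 _ _, j1 _ _, k1, ?_⟩
    rw [List.append_assoc]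
    refine h1.append_swap h1' hd fun a ha b hb => ?_
    rw [es] at ha
    rw [es'] at hb
    exact ha.elim (fun ha => (hv b hb a ha).symm) fun ha => (hy b hb a ha).symm
  · refine ⟨s' ++ s, p ++ t', j2 _ _, j1 _ _, j1 _ _, j2 _ _, k2, ?_⟩
    refine h1.insert_left h1' hd (fun a ha b hb => ?_) (fun a ha b hb h => ?_)
    · exact (hv b ((es' b).1 hb) a ((ep a).1 ha)).symm
    · exact hy b ((es' b).1 hb) a ((eq a).1 ha) h.symm
  · refine ⟨s ++ s', p ++ t', j1 _ _, j2 _ _, j1 _ _, j2 _ _, k2, ?_⟩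
    refine h1.insert_right h1' hd (fun a ha b hb h => ?_) (fun a ha b hb => ?_)
    · exact hv b ((es' b).1 hb) a ((ep a).1 ha) h.symm
    · exact (hy b ((es' b).1 hb) a ((eq a).1 ha)).symm
  · refine ⟨s' ++ s, t' ++ p, j2 _ _, j1 _ _, j2 _ _, j1 _ _, k1, ?_⟩
    rw [List.append_assoc]
    refine h1'.append h1 hd' fun b hb a ha h => ?_
    rw [es] at ha
    rw [es'] at hb
    exact ha.elim (fun ha => hv b hb a ha h) fun ha => hy b hb a ha h

end Adapted

/-! ### Merging partitions and maintaining adapted realisers -/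

/-- The family `P` consists of nonempty, pairwise disjoint sets. -/
structure IsParts (P : Set (Set V)) : Prop where
  nonempty : ∀ x ∈ P, x.Nonempty
  disjoint : ∀ x ∈ P, ∀ y ∈ P, x ≠ y → Disjoint x y

theorem IsParts.eq_of_mem {P : Set (Set V)} (h : IsParts P) {x y : Set V} (hx : x ∈ P)
    (hy : y ∈ P) {a : V} (hax : a ∈ x) (hay : a ∈ y) : x = y := by
  by_contra hne
  exact Set.disjoint_left.1 (h.disjoint x hx y hy hne) hax hay

theorem IsParts.eq_of_subset {P : Set (Set V)} (h : IsParts P) {x y : Set V} (hx : x ∈ P)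
    (hy : y ∈ P) (hxy : x ⊆ y) : x = y := by
  obtain ⟨a, ha⟩ := h.nonempty x hx
  exact h.eq_of_mem hx hy ha (hxy ha)

/-- The family obtained from `P` by replacing `u` and `v` by their union. -/
def merge (P : Set (Set V)) (u v : Set V) : Set (Set V) := insert (u ∪ v) (P \ {u, v})

theorem mem_merge {P : Set (Set V)} {u v x : Set V} :
    x ∈ merge P u v ↔ x = u ∪ v ∨ (x ∈ P ∧ x ≠ u ∧ x ≠ v) := by
  simp [merge]

theorem IsParts.merge {P : Set (Set V)} (h : IsParts P) {u v : Set V} (hu : u ∈ P)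
    (hv : v ∈ P) : IsParts (merge P u v) := by
  have key : ∀ x ∈ P, x ≠ u → x ≠ v → Disjoint (u ∪ v) x := fun x hx h1 h2 =>
    Set.disjoint_union_left.2 ⟨h.disjoint u hu x hx h1.symm, h.disjoint v hv x hx h2.symm⟩
  constructor
  · intro x hx
    rcases mem_merge.1 hx with rfl | ⟨hx, -⟩
    · exact (h.nonempty u hu).mono Set.subset_union_left
    · exact h.nonempty x hx
  · intro x hx y hy hne
    rcases mem_merge.1 hx with rfl | ⟨hx, h1, h2⟩ <;> rcases mem_merge.1 hy with rfl | ⟨hy, h3, h4⟩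
    · exact absurd rfl hne
    · exact key y hy h3 h4
    · exact (key x hx h1 h2).symm
    · exact h.disjoint x hx y hy hne

/-- Every member of `Q` is mixed with at most one other member. -/
def RedMatching (G : SimpleGraph V) (Q : Set (Set V)) : Prop :=
  ∀ x ∈ Q, ∀ y ∈ Q, ∀ z ∈ Q, x ≠ y → x ≠ z → Mixed G x y → Mixed G x z → y = z

/-- `MergePath P Q W`: the family `Q` is obtained from `P` by successive merges, through
the families in `W`. -/
inductive MergePath : Set (Set V) → Set (Set V) → Set (Set (Set V)) → Prop
  | refl (P : Set (Set V)) : MergePath P P {P}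
  | step {P Q : Set (Set V)} {W : Set (Set (Set V))} {u v : Set V} (hu : u ∈ P) (hv : v ∈ P)
      (huv : u ≠ v) (h : MergePath (merge P u v) Q W) : MergePath P Q (insert P W)

theorem MergePath.start_mem {P Q : Set (Set V)} {W : Set (Set (Set V))} (h : MergePath P Q W) :
    P ∈ W := by
  cases h <;> simp

/-- `z` belongs to one of the families in `H`. -/
def Visited (H : Set (Set (Set V))) (z : Set V) : Prop := ∃ Q ∈ H, z ∈ Q

/-- `z` and `z'` are distinct, mixed members of one of the families in `H`. -/
def VisitedRed (G : SimpleGraph V) (H : Set (Set (Set V))) (z z' : Set V) : Prop :=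
  ∃ Q ∈ H, z ∈ Q ∧ z' ∈ Q ∧ z ≠ z' ∧ Mixed G z z'

/-- Every component of the red graph on `P` has a realiser adapted to the families in `H`. -/
structure Realisable (G : SimpleGraph V) (H : Set (Set (Set V))) (P : Set (Set V)) : Prop where
  parts : IsParts P
  cover : ∀ z, Visited H z → z.Nonempty ∧ ∃ x ∈ P, z ⊆ x
  set : ∀ x ∈ P, (∀ y ∈ P, x ≠ y → ¬ Mixed G x y) →
    SetRealisable (Visited H) (VisitedRed G H) G x
  pair : ∀ x ∈ P, ∀ y ∈ P, x ≠ y → Mixed G x y →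
    PairRealisable (Visited H) (VisitedRed G H) G x y

theorem VisitedRed.symm {G : SimpleGraph V} {H : Set (Set (Set V))} (z z' : Set V)
    (h : VisitedRed G H z z') : VisitedRed G H z' z := by
  obtain ⟨Q, h1, h2, h3, h4, h5⟩ := h
  exact ⟨Q, h1, h3, h2, h4.symm, h5.symm⟩

theorem mixed_union_left {G : SimpleGraph V} {u v y : Set V} (h : Mixed G (u ∪ v) y)
    (hu : ¬ Mixed G u y) (hv : ¬ Mixed G v y) :
    ((∀ a ∈ u, ∀ b ∈ y, G.Adj a b) ∧ ∀ a ∈ v, ∀ b ∈ y, ¬ G.Adj a b) ∨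
    ((∀ a ∈ v, ∀ b ∈ y, G.Adj a b) ∧ ∀ a ∈ u, ∀ b ∈ y, ¬ G.Adj a b) := by
  rcases not_mixed_iff.1 hu with h1 | h1 <;> rcases not_mixed_iff.1 hv with h2 | h2
  · exact (not_mixed_iff.2 (Or.inl fun a ha => ha.elim (h1 a) (h2 a)) h).elim
  · exact Or.inl ⟨h1, h2⟩
  · exact Or.inr ⟨h2, h1⟩
  · exact (not_mixed_iff.2 (Or.inr fun a ha => ha.elim (h1 a) (h2 a)) h).elim

/-- When no third part is mixed with `u` or `v`, they are either a red component or two isolated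
parts; both cases lead to the same form of realiser. -/
theorem Realisable.merge_pair {G : SimpleGraph V} {H : Set (Set (Set V))} {P : Set (Set V)}
    (h : Realisable G H P) {u v : Set V} (hu : u ∈ P) (hv : v ∈ P) (huv : u ≠ v)
    (h1 : ∀ y ∈ P, y ≠ u → y ≠ v → ¬ Mixed G u y ∧ ¬ Mixed G v y) :
    PairRealisable (Visited H) (VisitedRed G H) G u v := by
  by_cases hm : Mixed G u v
  · exact h.pair u hu v hv huv hm
  · refine SetRealisable.pair (h.set u hu ?_) (h.set v hv ?_) (h.parts.disjoint u hu v hv huv) hm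
      fun z z' hz => ?_
    · intro y hy hne
      by_cases hyv : y = v
      · exact hyv ▸ hm
      · exact (h1 y hy hne.symm hyv).1
    · intro y hy hne
      by_cases hyu : y = u
      · exact hyu ▸ fun hm' => hm hm'.symm
      · exact (h1 y hy hyu hne.symm).2
    · obtain ⟨Q, -, -, -, -, h5⟩ := hz
      exact h5

/-- Earlier partitions are finer than `P`, so no recorded set straddles `u` and `v`. -/
theorem Realisable.merge_cover {G : SimpleGraph V} {H : Set (Set (Set V))} {P : Set (Set V)}
    (h : Realisable G H P) {u v : Set V} (hu : u ∈ P) (hv : v ∈ P) (z : Set V)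
    (hz : Visited H z) (hzu : z ⊆ u ∪ v) : z ⊆ u ∨ z ⊆ v := by
  obtain ⟨⟨a, ha⟩, x, hx, hzx⟩ := h.cover z hz
  rcases hzu ha with h1 | h1
  · exact Or.inl (h.parts.eq_of_mem hx hu (hzx ha) h1 ▸ hzx)
  · exact Or.inr (h.parts.eq_of_mem hx hv (hzx ha) h1 ▸ hzx)

/-- The matching condition after the merge makes `y` the only part that can be mixed with `u` or `v`
from outside. The cases are whether `y` was already mixed with one of them; the condition before the
merge excludes both. -/
theorem Realisable.union_pair {G : SimpleGraph V} {H : Set (Set (Set V))} {P : Set (Set V)}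
    (h : Realisable G H P) {u v : Set V} (hu : u ∈ P) (hv : v ∈ P) (huv : u ≠ v)
    (hP : RedMatching G P) (hP' : RedMatching G (merge P u v)) {y : Set V} (hy : y ∈ P)
    (hyu : y ≠ u) (hyv : y ≠ v) (hm : Mixed G (u ∪ v) y) :
    PairRealisable (Visited H) (VisitedRed G H) G (u ∪ v) y := by
  have hp := h.parts.merge hu hv
  have hne : ∀ x ∈ P, x ≠ u → x ≠ v → u ∪ v ≠ x := by
    rintro x hx h1 h2 rfl
    exact h1 (h.parts.eq_of_subset hu hx Set.subset_union_left).symm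
  have hR : ∀ z z', VisitedRed G H z z' → Visited H z ∧ Visited H z' := by
    rintro z z' ⟨Q, h1, h2, h3, -, -⟩
    exact ⟨⟨Q, h1, h2⟩, Q, h1, h3⟩
  have hRM : ∀ z z', VisitedRed G H z z' → Mixed G z z' := by
    rintro z z' ⟨Q, -, -, -, -, h5⟩
    exact h5
  have huy := h.parts.disjoint u hu y hy hyu.symm
  have hvy := h.parts.disjoint v hv y hy hyv.symm
  have duv := h.parts.disjoint u hu v hv huv
  have mu : u ∪ v ∈ merge P u v := mem_merge.2 (Or.inl rfl)
  have my : y ∈ merge P u v := mem_merge.2 (Or.inr ⟨hy, hyu, hyv⟩)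
  have iu : ∀ z ∈ P, z ≠ u → z ≠ v → z ≠ y → ¬ Mixed G u z ∧ ¬ Mixed G v z := by
    intro z hz h1 h2 h3
    have mz : z ∈ merge P u v := mem_merge.2 (Or.inr ⟨hz, h1, h2⟩)
    exact ⟨fun hm' => h3 (hP' _ mu _ mz _ my (hne z hz h1 h2) (hne y hy hyu hyv)
      (hm'.mono Set.subset_union_left subset_rfl) hm),
      fun hm' => h3 (hP' _ mu _ mz _ my (hne z hz h1 h2) (hne y hy hyu hyv)
      (hm'.mono Set.subset_union_right subset_rfl) hm)⟩
  have iy : ∀ z ∈ P, z ≠ u → z ≠ v → y ≠ z → ¬ Mixed G y z := by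
    intro z hz h1 h2 h3 hm'
    have mz : z ∈ merge P u v := mem_merge.2 (Or.inr ⟨hz, h1, h2⟩)
    exact hne z hz h1 h2 (hP' _ my _ mu _ mz (hne y hy hyu hyv).symm h3 hm.symm hm')
  -- Here the red edge to `y` is new, so `y` is completely joined to one of `u`, `v` and
  -- anticomplete to the other.
  have caseN : ¬ Mixed G u y → ¬ Mixed G v y →
      PairRealisable (Visited H) (VisitedRed G H) G (u ∪ v) y := by
    intro h1 h2
    have hq : PairRealisable (Visited H) (VisitedRed G H) G u v := by
      refine h.merge_pair hu hv huv fun z hz h3 h4 => ?_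
      by_cases h5 : z = y
      · exact h5 ▸ ⟨h1, h2⟩
      · exact iu z hz h3 h4 h5
    have hs : SetRealisable (Visited H) (VisitedRed G H) G y := by
      refine h.set y hy fun z hz hyz => ?_
      by_cases h5 : z = u
      · exact h5 ▸ fun h => h1 h.symm
      by_cases h6 : z = v
      · exact h6 ▸ fun h => h2 h.symm
      exact iy z hz h5 h6 hyz
    rcases mixed_union_left hm h1 h2 with ⟨h3, h4⟩ | ⟨h3, h4⟩
    · exact hq.union_pair hs VisitedRed.symm (h.merge_cover hu hv) hR hRM huy hvy h3 h4
    · rw [Set.union_comm]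
      exact (hq.symm VisitedRed.symm).union_pair hs VisitedRed.symm (h.merge_cover hv hu) hR hRM
        hvy huy h3 h4
  -- The sets are quantified again because the argument is used with `u` and `v` exchanged. Since
  -- `v` is mixed with `y`, a red edge `uv` or `uy` would give `v` or `y` two red neighbours, so `u`
  -- is isolated.
  have caseS : ∀ {u v}, u ∈ P → v ∈ P → u ≠ v → y ≠ u → y ≠ v →
      (∀ z ∈ P, z ≠ u → z ≠ v → z ≠ y → ¬ Mixed G u z ∧ ¬ Mixed G v z) → 
      Mixed G v y → PairRealisable (Visited H) (VisitedRed G H) G (u ∪ v) y := by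
    intro u v hu hv huv hyu hyv iu hvm
    have n1 : ¬ Mixed G u v := fun h' =>
      hyu (hP v hv y hy u hu hyv.symm huv.symm hvm h'.symm)
    have n2 : ¬ Mixed G u y := fun h' =>
      huv (hP y hy u hu v hv hyu hyv h'.symm hvm.symm)
    refine SetRealisable.union_pair (h.set u hu fun z hz huz => ?_) (h.pair v hv y hy hyv.symm hvm)
      VisitedRed.symm (h.merge_cover hu hv) hR hRM (h.parts.disjoint u hu v hv huv)
      (h.parts.disjoint u hu y hy hyu.symm) n1 n2
    by_cases h1 : z = v
    · exact h1 ▸ n1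
    by_cases h2 : z = y
    · exact h2 ▸ n2
    exact (iu z hz huz.symm h1 h2).1
  by_cases h1 : Mixed G v y
  · exact caseS hu hv huv hyu hyv iu h1
  by_cases h2 : Mixed G u y
  · rw [Set.union_comm]
    exact caseS hv hu huv.symm hyv hyu (fun z hz h1 h2 h3 => (iu z hz h2 h1 h3).symm) h2
  exact caseN h2 h1

/-- The inductive step along the chain. Components away from `u` and `v` keep their realisers; the
component of `u ∪ v` is rebuilt, and the new partition is then recorded at no cost. -/
theorem Realisable.merge {G : SimpleGraph V} {H : Set (Set (Set V))} {P : Set (Set V)}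
    (h : Realisable G H P) {u v : Set V} (hu : u ∈ P) (hv : v ∈ P) (huv : u ≠ v)
    (hP : RedMatching G P) (hP' : RedMatching G (merge P u v)) :
    Realisable G (insert (merge P u v) H) (merge P u v) := by
  have hp := h.parts.merge hu hv
  have hne : ∀ x ∈ P, x ≠ u → x ≠ v → u ∪ v ≠ x := by
    rintro x hx h1 h2 rfl
    exact h1 (h.parts.eq_of_subset hu hx Set.subset_union_left).symm
  have mu : u ∪ v ∈ TwinWidthOne.merge P u v := mem_merge.2 (Or.inl rfl)
  have eV : ∀ x ∈ TwinWidthOne.merge P u v, ∀ z,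
      Visited (insert (TwinWidthOne.merge P u v) H) z → z ⊆ x → Visited H z ∨ z = x := by
    rintro x hx z ⟨Q, rfl | hQ, hz⟩ hzx
    · exact Or.inr (hp.eq_of_subset hz hx hzx)
    · exact Or.inl ⟨Q, hQ, hz⟩
  have eR : ∀ x ∈ TwinWidthOne.merge P u v, ∀ z z',
      VisitedRed G (insert (TwinWidthOne.merge P u v) H) z z' → z ⊆ x → z' ⊆ x →
        VisitedRed G H z z' := by
    rintro x hx z z' ⟨Q, rfl | hQ, hz, hz', hzz, hm⟩ hzx hzx'
    · exact (hzz ((hp.eq_of_subset hz hx hzx).trans (hp.eq_of_subset hz' hx hzx').symm)).elim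
    · exact ⟨Q, hQ, hz, hz', hzz, hm⟩
  have eC : ∀ x ∈ TwinWidthOne.merge P u v, ∀ y ∈ TwinWidthOne.merge P u v, ∀ z z',
      VisitedRed G (insert (TwinWidthOne.merge P u v) H) z z' → z ⊆ x → z' ⊆ y →
        VisitedRed G H z z' ∨ (z = x ∧ z' = y) := by
    rintro x hx y hy z z' ⟨Q, rfl | hQ, hz, hz', hzz, hm⟩ hzx hzx'
    · exact Or.inr ⟨hp.eq_of_subset hz hx hzx, hp.eq_of_subset hz' hy hzx'⟩
    · exact Or.inl ⟨Q, hQ, hz, hz', hzz, hm⟩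
  refine ⟨hp, ?_, ?_, ?_⟩
  · rintro z ⟨Q, rfl | hQ, hz⟩
    · exact ⟨hp.nonempty z hz, z, hz, subset_rfl⟩
    · obtain ⟨h1, x, hx, hzx⟩ := h.cover z ⟨Q, hQ, hz⟩
      refine ⟨h1, ?_⟩
      by_cases hxu : x = u
      · exact ⟨u ∪ v, mu, hzx.trans (hxu ▸ Set.subset_union_left)⟩
      by_cases hxv : x = v
      · exact ⟨u ∪ v, mu, hzx.trans (hxv ▸ Set.subset_union_right)⟩
      exact ⟨x, mem_merge.2 (Or.inr ⟨hx, hxu, hxv⟩), hzx⟩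
  · intro x hx hi
    refine SetRealisable.extend (HV := Visited H) (HR := VisitedRed G H) ?_ (eV x hx) (eR x hx)
    rcases mem_merge.1 hx with rfl | ⟨hxP, hxu, hxv⟩
    · refine (h.merge_pair hu hv huv fun y hy h1 h2 => ?_).union VisitedRed.symm
        (h.merge_cover hu hv) ?_
      · have := hi y (mem_merge.2 (Or.inr ⟨hy, h1, h2⟩)) (hne y hy h1 h2)
        exact ⟨fun hm => this (hm.mono Set.subset_union_left subset_rfl),
          fun hm => this (hm.mono Set.subset_union_right subset_rfl)⟩
      · rintro z z' ⟨Q, h1, h2, h3, -, -⟩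
        exact ⟨⟨Q, h1, h2⟩, Q, h1, h3⟩
    · refine h.set x hxP fun y hy hxy hm => ?_
      by_cases hyu : y = u
      · exact hi _ mu (hne x hxP hxu hxv).symm
          (hm.mono subset_rfl (hyu ▸ Set.subset_union_left))
      by_cases hyv : y = v
      · exact hi _ mu (hne x hxP hxu hxv).symm
          (hm.mono subset_rfl (hyv ▸ Set.subset_union_right))
      exact hi y (mem_merge.2 (Or.inr ⟨hy, hyu, hyv⟩)) hxy hm
  · intro x hx y hy hxy hm
    refine PairRealisable.extend (HV := Visited H) (HR := VisitedRed G H) ?_ (eV x hx) (eV y hy)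
      (eR x hx) (eR y hy) (eC x hx y hy)
    rcases mem_merge.1 hx with rfl | ⟨hxP, hxu, hxv⟩ <;>
      rcases mem_merge.1 hy with rfl | ⟨hyP, hyu, hyv⟩
    · exact absurd rfl hxy
    · exact h.union_pair hu hv huv hP hP' hyP hyu hyv hm
    · exact (h.union_pair hu hv huv hP hP' hxP hxu hxv hm.symm).symm VisitedRed.symm
    · exact h.pair x hxP y hyP hxy hm

/-- The partition of `A` into singletons. -/
def singletons (A : Set V) : Set (Set V) := (fun a => {a}) '' A

theorem isParts_singletons (A : Set V) : IsParts (singletons A) := by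
  constructor
  · rintro x ⟨a, -, rfl⟩
    exact ⟨a, rfl⟩
  · rintro x ⟨a, -, rfl⟩ y ⟨b, -, rfl⟩ hne
    rw [Set.disjoint_singleton]
    rintro rfl
    exact hne rfl

theorem not_mixed_singletons (G : SimpleGraph V) (a b : V) : ¬ Mixed G {a} {b} := by
  rintro ⟨⟨a', rfl, b', rfl, h⟩, c, rfl, d, rfl, h'⟩
  exact h' h

theorem realisable_singletons (G : SimpleGraph V) (A : Set V) :
    Realisable G {singletons A} (singletons A) := by
  refine ⟨isParts_singletons A, ?_, ?_, ?_⟩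
  · rintro z ⟨Q, rfl, hz⟩
    exact ⟨(isParts_singletons A).nonempty z hz, z, hz, subset_rfl⟩
  · rintro x ⟨a, ha, rfl⟩ -
    refine ⟨[a], [a], ⟨List.nodup_singleton a, List.Perm.refl _, ?_⟩, by ext; simp, ?_, ?_⟩
    · intro b c h
      exact absurd h.length_le (by simp)
    · rintro z ⟨Q, rfl, b, hb, rfl⟩ h
      rw [Set.singleton_subset_singleton] at h
      exact Or.inl (isFactor_self (by ext; simp [h]))
    · rintro z z' ⟨Q, rfl, ⟨b, hb, rfl⟩, ⟨c, hc, rfl⟩, -, hm⟩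
      exact (not_mixed_singletons G b c hm).elim
  · rintro x ⟨a, ha, rfl⟩ y ⟨b, hb, rfl⟩ - hm
    exact (not_mixed_singletons G a b hm).elim

/-- `H` accumulates the partitions already passed, so that the final realiser is adapted to all of
them simultaneously. -/
theorem Realisable.of_path {G : SimpleGraph V} {P Q : Set (Set V)} {W : Set (Set (Set V))}
    (hW : MergePath P Q W) (hG : ∀ R ∈ W, RedMatching G R) {H : Set (Set (Set V))}
    (h : Realisable G H P) (hH : P ∈ H) : Realisable G (W ∪ H) Q := by
  induction hW generalizing H with
  | refl P => rwa [Set.union_eq_self_of_subset_left (Set.singleton_subset_iff.2 hH)]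
  | @step P Q W u v hu hv huv hp ih =>
    have := ih (fun R hR => hG R (Set.mem_insert_of_mem _ hR))
      (h.merge hu hv huv (hG P (Set.mem_insert _ _))
        (hG _ (Set.mem_insert_of_mem _ hp.start_mem))) (Set.mem_insert _ _)
    rw [Set.union_insert, Set.insert_eq_of_mem (Set.mem_union_left _ hp.start_mem)] at this
    rwa [Set.insert_union, Set.insert_eq_of_mem (Set.mem_union_right _ hH)]

/-! ### Orderings as integer-valued functions -/

/-- `z` is an interval of the ordering of `A` given by `f`. -/
def ConvexIn (f : V → ℤ) (A z : Set V) : Prop :=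
  ∀ a ∈ z, ∀ c ∈ z, ∀ b ∈ A, f a < f b → f b < f c → b ∈ z

/-- The orderings of `A` given by `f` and `g` realise the subgraph of `G` induced on `A`. -/
structure FnRealises (G : SimpleGraph V) (A : Set V) (f g : V → ℤ) : Prop where
  injOn_left : Set.InjOn f A
  injOn_right : Set.InjOn g A
  adj_iff : ∀ a ∈ A, ∀ b ∈ A, a ≠ b → (G.Adj a b ↔ (f a < f b ↔ g b < g a))

/-- The orderings of `A` given by `f` and `g` are adapted to the family `Q`. -/
structure AdaptedTo (G : SimpleGraph V) (A : Set V) (f g : V → ℤ) (Q : Set (Set V)) : Prop where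
  vertex : ∀ x ∈ Q, ConvexIn f A x ∨ ConvexIn g A x
  red : ∀ x ∈ Q, ∀ y ∈ Q, x ≠ y → Mixed G x y →
    (ConvexIn f A (x ∪ y) ∧ ConvexIn g A x ∧ ConvexIn g A y) ∨
    (ConvexIn g A (x ∪ y) ∧ ConvexIn f A x ∧ ConvexIn f A y)

open Classical in
theorem idxOf_lt_idxOf {l : List V} (hl : l.Nodup) {a b : V} (ha : a ∈ l) (hb : b ∈ l) :
    (l.idxOf a : ℤ) < l.idxOf b ↔ Before l a b := by
  have key : ∀ {a b}, Before l a b → l.idxOf a < l.idxOf b := by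
    clear ha hb
    intro a b h
    induction l with
    | nil => simp [Before] at h
    | cons c l ih =>
      rw [List.nodup_cons] at hl
      rw [before_cons] at h
      rcases h with ⟨rfl, h⟩ | h
      · have : a ≠ b := by rintro rfl; exact hl.1 h
        rw [List.idxOf_cons_self, List.idxOf_cons_ne _ this]
        omega
      · have h1 : c ≠ a := by rintro rfl; exact hl.1 h.left_mem
        have h2 : c ≠ b := by rintro rfl; exact hl.1 h.right_mem
        rw [List.idxOf_cons_ne _ h1, List.idxOf_cons_ne _ h2]
        exact Nat.succ_lt_succ (ih hl.2 h)
  refine ⟨fun h => ?_, fun h => by exact_mod_cast key h⟩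
  have hne : a ≠ b := by rintro rfl; omega
  rcases before_total ha hb hne with h' | h'
  · exact h'
  · have := key h'
    omega

open Classical in
theorem IsFactor.convexIn {l : List V} (hl : l.Nodup) {z : Set V} (h : IsFactor l z) :
    ConvexIn (fun a => (l.idxOf a : ℤ)) {a | a ∈ l} z := by
  obtain ⟨m, hm, rfl⟩ := h
  intro a ha c hc b hb h1 h2
  have hml := hm.subset
  have h3 := (idxOf_lt_idxOf hl (hml ha) hb).1 h1
  have h4 := (idxOf_lt_idxOf hl hb (hml hc)).1 h2
  obtain ⟨p, q, rfl⟩ := hm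
  simp only [Set.mem_ofPred_eq, List.mem_append] at ha hc hb ⊢
  rcases hb with (hb | hb) | hb
  · refine (h3.asymm hl ?_).elim
    rw [before_append, before_append]
    exact Or.inl (Or.inr (Or.inl ⟨hb, ha⟩))
  · exact hb
  · refine (h4.asymm hl ?_).elim
    rw [before_append, before_append]
    exact Or.inr (Or.inl ⟨List.mem_append_right _ hc, hb⟩)

open Classical in
theorem ListRealises.fnRealises {G : SimpleGraph V} {s t : List V} (h : ListRealises G s t) :
    FnRealises G {a | a ∈ s} (fun a => (s.idxOf a : ℤ)) fun a => (t.idxOf a : ℤ) := by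
  have ht : ∀ {a}, a ∈ s → a ∈ t := fun ha => h.perm.mem_iff.1 ha
  refine ⟨fun a ha b hb hab => ?_, fun a ha b hb hab => ?_, fun a ha b hb hab => ?_⟩
  · exact (List.idxOf_inj ha).1 (by exact_mod_cast hab)
  · exact (List.idxOf_inj (ht ha)).1 (by exact_mod_cast hab)
  · rw [idxOf_lt_idxOf h.nodup ha hb, idxOf_lt_idxOf h.nodup_right (ht hb) (ht ha)]
    rcases before_total ha hb hab with h1 | h1
    · have := h.adj_iff _ _ h1
      tauto
    · have h2 := h.adj_iff _ _ h1
      have h3 := h1.asymm h.nodup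
      have h4 := before_total (ht ha) (ht hb) hab
      have h5 := fun h' : Before t a b => h'.asymm h.nodup_right
      rw [G.adj_comm]
      tauto

/-- A sequence of merges from the singletons of `A` to `A` in which all red graphs are
matchings has an adapted realiser. -/
theorem MergePath.exists_adapted {G : SimpleGraph V} {A : Set V} {W : Set (Set (Set V))}
    (hW : MergePath (singletons A) {A} W) (hG : ∀ R ∈ W, RedMatching G R) :
    ∃ f g, FnRealises G A f g ∧ ∀ Q ∈ W, AdaptedTo G A f g Q := by
  classical
  have h := (realisable_singletons G A).of_path hW hG rfl
  have hsub : ∀ z, Visited W z → z ⊆ A := by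
    rintro z ⟨Q, hQ, hz⟩
    obtain ⟨-, x, rfl, hx⟩ := h.cover z ⟨Q, Or.inl hQ, hz⟩
    exact hx
  obtain ⟨s, t, h1, rfl, h3, h4⟩ := h.set A rfl fun y hy hne => (hne hy.symm).elim
  have e : {a | a ∈ s} = {a | a ∈ t} := by ext a; exact h1.perm.mem_iff
  have cs : ∀ z, IsFactor s z → ConvexIn (fun a => (s.idxOf a : ℤ)) {a | a ∈ s} z :=
    fun z hz => hz.convexIn h1.nodup
  have ct : ∀ z, IsFactor t z → ConvexIn (fun a => (t.idxOf a : ℤ)) {a | a ∈ s} z :=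
    fun z hz => by rw [e]; exact hz.convexIn h1.nodup_right
  refine ⟨_, _, h1.fnRealises, fun Q hQ => ⟨fun x hx => ?_, fun x hx y hy hxy hm => ?_⟩⟩
  · exact (h3 x ⟨Q, Or.inl hQ, hx⟩ (hsub x ⟨Q, hQ, hx⟩)).imp (cs x) (ct x)
  · exact (h4 x y ⟨Q, Or.inl hQ, hx, hy, hxy, hm⟩ (hsub x ⟨Q, hQ, hx⟩) (hsub y ⟨Q, hQ, hy⟩)).imp
      (fun k => ⟨cs _ k.1, ct _ k.2.1, ct _ k.2.2⟩) fun k => ⟨ct _ k.1, cs _ k.2.1, cs _ k.2.2⟩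

/-! ### Colourings without rainbow triangles -/

section Coloring

variable {α : Type*}

/-- A colouring of the pairs of elements of `A` without rainbow triangles. -/
structure GallaiColoring (c : α → α → Fin 3) (A : Set α) : Prop where
  symm : ∀ a ∈ A, ∀ b ∈ A, c a b = c b a
  triangle : ∀ a ∈ A, ∀ b ∈ A, ∀ d ∈ A, a ≠ b → b ≠ d → a ≠ d →
    c a b = c b d ∨ c a b = c a d ∨ c b d = c a d

/-- `a` and `b` are joined by a path of colour `k` in `A`. -/
def Linked (c : α → α → Fin 3) (k : Fin 3) (A : Set α) : α → α → Prop :=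
  Relation.ReflTransGen fun a b => a ∈ A ∧ b ∈ A ∧ c a b = k

theorem Linked.mem {c : α → α → Fin 3} {k : Fin 3} {A : Set α} {a b : α} (h : Linked c k A a b)
    (ha : a ∈ A) : b ∈ A := by
  induction h with
  | refl => exact ha
  | tail _ h _ => exact h.2.1

theorem Linked.trans {c : α → α → Fin 3} {k : Fin 3} {A : Set α} {a b d : α}
    (h : Linked c k A a b) (h' : Linked c k A b d) : Linked c k A a d :=
  Relation.ReflTransGen.trans h h'

theorem GallaiColoring.linked_symm {c : α → α → Fin 3} {A : Set α} (hc : GallaiColoring c A)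
    {k : Fin 3} {a b : α} (h : Linked c k A a b) : Linked c k A b a := by
  induction h with
  | refl => exact .refl
  | @tail b d _ h ih =>
    exact Relation.ReflTransGen.head ⟨h.2.1, h.1, (hc.symm d h.2.1 b h.1).trans h.2.2⟩ ih

theorem GallaiColoring.ne_of_not_linked {c : α → α → Fin 3} {A : Set α}
    (hc : GallaiColoring c A) {k : Fin 3} {a b w : α} (ha : a ∈ A) (hw : w ∈ A)
    (haw : ¬ Linked c k A a w) (h : Linked c k A a b) : c w b ≠ k := by
  intro h'
  have hb := h.mem ha
  exact haw (h.tail ⟨hb, hw, (hc.symm b hb w hw).trans h'⟩)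

/-- A vertex `w` outside a component of colour `k` sends no colour `k` into it. In the triangle
formed by `w` and an edge of colour `k`, the other two sides must therefore have equal colours; this
propagates along the path. -/
theorem GallaiColoring.eq_of_linked {c : α → α → Fin 3} {A : Set α}
    (hc : GallaiColoring c A) {k : Fin 3} {a b w : α} (ha : a ∈ A) (hw : w ∈ A)
    (haw : ¬ Linked c k A a w) (h : Linked c k A a b) : c w b = c w a := by
  induction h with
  | refl => rfl
  | @tail b d hb hd ih =>
    rw [← ih]
    have hd' : Linked c k A a d := Relation.ReflTransGen.tail hb hd
    have n1 := hc.ne_of_not_linked ha hw haw hb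
    have n2 := hc.ne_of_not_linked ha hw haw hd'
    have w1 : w ≠ b := by rintro rfl; exact haw hb
    have w2 : w ≠ d := by rintro rfl; exact haw hd'
    by_cases hbd : b = d
    · rw [hbd]
    rcases hc.triangle w hw b hd.1 d hd.2.1 w1 hbd w2 with h | h | h
    · exact absurd (h.trans hd.2.2) n1
    · exact h.symm
    · exact absurd (h.symm.trans hd.2.2) n2

/-- In a colouring without rainbow triangles, some colour is disconnected. -/
theorem GallaiColoring.exists_cut {c : α → α → Fin 3} (A : Finset α) (hA : 2 ≤ A.card)
    (hc : GallaiColoring c A) :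
    ∃ k, ∃ U ⊆ A, U.Nonempty ∧ U ≠ A ∧ ∀ a ∈ U, ∀ b ∈ A, b ∉ U → c a b ≠ k := by
  classical
  induction A using Finset.induction_on with
  | empty => simp at hA
  | @insert v A hv ih =>
    rw [Finset.card_insert_of_notMem hv] at hA
    have hcA : GallaiColoring c A := ⟨fun a ha b hb => hc.symm a (by simp_all) b (by simp_all),
      fun a ha b hb d hd => hc.triangle a (by simp_all) b (by simp_all) d (by simp_all)⟩
    have sv : ∀ a ∈ A, c a v = c v a := fun a ha => hc.symm a (by simp_all) v (by simp)
    -- If every colour is connected after adding `v`, then `v` sends every colour to `A`, and it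
    -- sends the colour `k` disconnected on `A` into each component of that colour.
    by_contra! hcon
    have hvA : ∀ k, ∃ a ∈ A, c v a = k := by
      intro k
      obtain ⟨a, ha, b, hb, hb', h⟩ := hcon k {v} (by simp) (by simp) (by
        intro h
        have := congrArg Finset.card h
        rw [Finset.card_insert_of_notMem hv, Finset.card_singleton] at this
        omega)
      rw [Finset.mem_singleton] at ha hb'
      subst ha
      exact ⟨b, (Finset.mem_insert.1 hb).resolve_left hb', h⟩
    by_cases hA1 : A.card < 2
    · obtain ⟨a, rfl⟩ := Finset.card_eq_one.1 (by omega : A.card = 1)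
      obtain ⟨b, hb, h0⟩ := hvA 0
      obtain ⟨d, hd, h1⟩ := hvA 1
      rw [Finset.mem_singleton] at hb hd
      subst hb hd
      rw [h0] at h1
      exact absurd h1 (by decide)
    obtain ⟨k, U, hUA, hU, hU', hcut⟩ := ih (by omega) hcA
    obtain ⟨k₂, k₃, hk₂, hk₃, hk⟩ : ∃ k₂ k₃ : Fin 3, k₂ ≠ k ∧ k₃ ≠ k ∧ k₂ ≠ k₃ := by
      clear * -
      revert k
      decide
    obtain ⟨p, hp⟩ := hU
    obtain ⟨q, hq, hqU⟩ : ∃ q ∈ A, q ∉ U := by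
      by_contra! h
      exact hU' (Finset.Subset.antisymm hUA h)
    have hpq : ¬ Linked c k A p q := by
      intro h
      have : ∀ b, Linked c k A p b → b ∈ U := by
        intro b hb
        induction hb with
        | refl => exact hp
        | @tail b d _ hbd ih =>
          by_contra hd
          exact hcut b ih d hbd.2.1 hd hbd.2.2
      exact hqU (this q h)
    have hout : ∀ x, ∃ y ∈ A, ¬ Linked c k A x y := by
      intro x
      by_contra! h
      exact hpq ((hcA.linked_symm (h p (hUA hp))).trans (h q hq))
    have hvk : ∀ x ∈ A, ∃ y ∈ A, Linked c k A x y ∧ c v y = k := by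
      intro x hx
      obtain ⟨a, ha, b, hb, hb', h⟩ := hcon k {y ∈ A | Linked c k A x y}
        ((Finset.filter_subset _ _).trans (Finset.subset_insert _ _))
        ⟨x, Finset.mem_filter.2 ⟨hx, .refl⟩⟩ (by
          intro h
          have : v ∈ ({y ∈ A | Linked c k A x y} : Finset α) := h ▸ Finset.mem_insert_self _ _
          exact hv (Finset.mem_filter.1 this).1)
      rw [Finset.mem_filter] at ha hb'
      rcases Finset.mem_insert.1 hb with rfl | hb
      · exact ⟨a, ha.1, ha.2, (sv a ha.1).symm.trans h⟩
      · exact (hb' ⟨hb, ha.2.tail ⟨ha.1, hb, h⟩⟩).elim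
    -- The triangle `v`, `w`, `u` has `vw` of colour `k` and its two other sides of colours
    -- different from `k`.
    have key : ∀ u ∈ A, ∀ w ∈ A, c v w = k → ¬ Linked c k A u w → c v u ≠ k →
        c w u = c v u := by
      intro u hu w hw h1 h2 h3
      have hne : u ≠ w := by rintro rfl; exact h2 .refl
      have h4 := hcA.ne_of_not_linked hu hw h2 .refl
      have := hc.triangle v (by simp) w (by simp [hw]) u (by simp [hu])
        (by rintro rfl; exact hv hw) hne.symm (by rintro rfl; exact hv hu)
      rw [h1] at this
      rcases this with h | h | h
      · exact absurd h.symm h4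
      · exact absurd h.symm h3
      · exact h
    obtain ⟨u₂, hu₂, e₂⟩ := hvA k₂
    obtain ⟨u₃, hu₃, e₃⟩ := hvA k₃
    -- In one component, `u₂` and `u₃` receive the same colour from a vertex `w` of another
    -- component; taking `w` joined to `v` by colour `k`, this colour is both `k₂` and `k₃`.
    by_cases hl : Linked c k A u₂ u₃
    · obtain ⟨w₀, hw₀, hn⟩ := hout u₂
      obtain ⟨w, hw, hww, hvw⟩ := hvk w₀ hw₀
      have hn2 : ¬ Linked c k A u₂ w := fun h => hn (h.trans (hcA.linked_symm hww))
      have hn3 : ¬ Linked c k A u₃ w := fun h => hn2 (hl.trans h)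
      have h2 := key u₂ hu₂ w hw hvw hn2 (e₂ ▸ hk₂)
      have h3 := key u₃ hu₃ w hw hvw hn3 (e₃ ▸ hk₃)
      have := hcA.eq_of_linked hu₂ hw hn2 hl
      rw [h2, h3, e₂, e₃] at this
      exact hk this.symm
    -- In different components, all pairs between the two components have the same colour; measured
    -- at `u₂` and at `u₃` it is `k₂` and `k₃`.
    · have hl' : ¬ Linked c k A u₃ u₂ := fun h => hl (hcA.linked_symm h)
      obtain ⟨w₃, hw₃, hl3, hv3⟩ := hvk u₃ hu₃
      obtain ⟨w₂, hw₂, hl2, hv2⟩ := hvk u₂ hu₂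
      have h2 := key u₂ hu₂ w₃ hw₃ hv3 (fun h => hl (h.trans (hcA.linked_symm hl3))) (e₂ ▸ hk₂)
      have h3 := key u₃ hu₃ w₂ hw₂ hv2 (fun h => hl' (h.trans (hcA.linked_symm hl2))) (e₃ ▸ hk₃)
      have h4 := hcA.eq_of_linked hu₃ hu₂ hl' hl3
      have h5 := hcA.eq_of_linked hu₂ hu₃ hl hl2
      rw [hcA.symm _ hu₂ _ hw₃, h2, e₂] at h4
      rw [hcA.symm _ hu₃ _ hw₂, h3, e₃, hcA.symm _ hu₃ _ hu₂, ← h4] at h5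
      exact hk h5.symm

/-- A path of colour `k` which passes from one side of `t` to the other one
has an edge which does so. -/
theorem Linked.exists_crossing {c : α → α → Fin 3} {k : Fin 3} {A : Set α} {x y : α}
    (h : Linked c k A x y) {f : α → ℤ} {t : ℤ} (hx : f x < t) (hy : t < f y)
    (hA : ∀ b, Linked c k A x b → f b ≠ t) :
    ∃ a b, Linked c k A x a ∧ Linked c k A x b ∧ c a b = k ∧ f a < t ∧ t < f b := by
  induction h with
  | refl => omega
  | @tail b d hb hbd ih =>
    by_cases h : t < f b
    · exact ih h
    · exact ⟨b, d, hb, Relation.ReflTransGen.tail hb hbd, hbd.2.2,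
        lt_of_le_of_ne (not_lt.1 h) (hA b hb), hy⟩

end Coloring

/-! ### Uniqueness of a realiser without common intervals -/

open Classical in
/-- Edges on which `f` and `f'` agree have colour `0`, the other edges colour `1` and
non-edges colour `2`. -/
noncomputable def agreement (G : SimpleGraph V) (f f' : V → ℤ) (a b : V) : Fin 3 :=
  if G.Adj a b then if f a < f b ↔ f' a < f' b then 0 else 1 else 2

theorem FnRealises.lt_or_gt {G : SimpleGraph V} {A : Set V} {f g : V → ℤ}
    (h : FnRealises G A f g) {a b : V} (ha : a ∈ A) (hb : b ∈ A) (hab : a ≠ b) :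
    (f a < f b ∧ ¬ f b < f a ∨ ¬ f a < f b ∧ f b < f a) ∧
    (g a < g b ∧ ¬ g b < g a ∨ ¬ g a < g b ∧ g b < g a) := by
  have h1 : f a ≠ f b := fun h' => hab (h.injOn_left ha hb h')
  have h2 : g a ≠ g b := fun h' => hab (h.injOn_right ha hb h')
  omega

/-- A rainbow triangle would have exactly one non-edge `ad` and a third vertex `b` joined to both
ends. By transitivity `b` lies on the same side of `a` and `d` for `f`, and likewise for `f'`, so
the two edges at `b` have the same colour. -/
theorem FnRealises.gallaiColoring {G : SimpleGraph V} {A : Set V} {f g f' g' : V → ℤ}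
    (h : FnRealises G A f g) (h' : FnRealises G A f' g') :
    GallaiColoring (agreement G f f') A := by
  constructor
  · intro a ha b hb
    rcases eq_or_ne a b with rfl | hab
    · rfl
    have h1 := h.lt_or_gt ha hb hab
    have h2 := h'.lt_or_gt ha hb hab
    have e : (f b < f a ↔ f' b < f' a) ↔ (f a < f b ↔ f' a < f' b) := by tauto
    by_cases hadj : G.Adj a b
    · simp [agreement, hadj, hadj.symm, e]
    · simp [agreement, hadj, mt (G.adj_comm b a).1 hadj]
  · intro a ha b hb d hd hab hbd had
    have a1 := h.adj_iff a ha b hb hab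
    have a2 := h.adj_iff b hb d hd hbd
    have a3 := h.adj_iff a ha d hd had
    have b1 := h'.adj_iff a ha b hb hab
    have b2 := h'.adj_iff b hb d hd hbd
    have b3 := h'.adj_iff a ha d hd had
    have l1 : f a ≠ f b := fun k => hab (h.injOn_left ha hb k)
    have l2 : f b ≠ f d := fun k => hbd (h.injOn_left hb hd k)
    have l3 : f a ≠ f d := fun k => had (h.injOn_left ha hd k)
    have m1 : g a ≠ g b := fun k => hab (h.injOn_right ha hb k)
    have m2 : g b ≠ g d := fun k => hbd (h.injOn_right hb hd k)
    have m3 : g a ≠ g d := fun k => had (h.injOn_right ha hd k)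
    have l1' : f' a ≠ f' b := fun k => hab (h'.injOn_left ha hb k)
    have l2' : f' b ≠ f' d := fun k => hbd (h'.injOn_left hb hd k)
    have l3' : f' a ≠ f' d := fun k => had (h'.injOn_left ha hd k)
    have m1' : g' a ≠ g' b := fun k => hab (h'.injOn_right ha hb k)
    have m2' : g' b ≠ g' d := fun k => hbd (h'.injOn_right hb hd k)
    have m3' : g' a ≠ g' d := fun k => had (h'.injOn_right ha hd k)
    unfold agreement
    by_cases e1 : G.Adj a b <;> by_cases e2 : G.Adj b d <;> by_cases e3 : G.Adj a d <;>
      simp only [e1, e2, e3, if_true, if_false, true_iff, false_iff] at a1 a2 a3 b1 b2 b3 ⊢ <;>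
      first | simp | (split_ifs <;> first | (simp; done) | (exfalso; omega))

/-- If a vertex `w` outside a component lay between two of its elements, it would lie between the
ends of an edge `ab` of colour `k`. Since `wa` and `wb` have the same colour, transitivity gives
that colour to `ab` too, although it differs from `k`. -/
theorem agreement_convex {G : SimpleGraph V} {A : Set V} {f g f' g' : V → ℤ}
    (h : FnRealises G A f g) (h' : FnRealises G A f' g') {k : Fin 3} {x : V} (hx : x ∈ A) :
    ConvexIn f A {y | Linked (agreement G f f') k A x y} ∧
    ConvexIn g A {y | Linked (agreement G f f') k A x y} := by
  have hc := h.gallaiColoring h'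
  have key : ∀ a ∈ A, ∀ b ∈ A, ∀ w ∈ A, agreement G f f' a b = k →
      agreement G f f' w a = agreement G f f' w b → agreement G f f' w b ≠ k →
      a ≠ b → w ≠ a → w ≠ b → ¬ (f a < f w ∧ f w < f b) ∧ ¬ (g a < g w ∧ g w < g b) := by
    intro a ha b hb w hw h1 h2 h3 hab hwa hwb
    subst h1
    have a1 := h.adj_iff a ha b hb hab
    have a2 := h.adj_iff w hw a ha hwa
    have a3 := h.adj_iff w hw b hb hwb
    have l1 : f a ≠ f b := fun k => hab (h.injOn_left ha hb k)
    have l2 : f w ≠ f a := fun k => hwa (h.injOn_left hw ha k)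
    have l3 : f w ≠ f b := fun k => hwb (h.injOn_left hw hb k)
    have m1 : g a ≠ g b := fun k => hab (h.injOn_right ha hb k)
    have m2 : g w ≠ g a := fun k => hwa (h.injOn_right hw ha k)
    have m3 : g w ≠ g b := fun k => hwb (h.injOn_right hw hb k)
    have l1' : f' a ≠ f' b := fun k => hab (h'.injOn_left ha hb k)
    have l2' : f' w ≠ f' a := fun k => hwa (h'.injOn_left hw ha k)
    have l3' : f' w ≠ f' b := fun k => hwb (h'.injOn_left hw hb k)
    unfold agreement at h2 h3
    by_cases e1 : G.Adj a b <;> by_cases e2 : G.Adj w a <;> by_cases e3 : G.Adj w b <;>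
      simp only [e1, e2, e3, if_true, if_false, true_iff, false_iff] at a1 a2 a3 h2 h3 <;>
      (try split_ifs at h2 h3) <;> first | (simp at h2; done) | (simp at h3; done) | omega
  have gen : ∀ F : V → ℤ, Set.InjOn F A → (∀ a ∈ A, ∀ b ∈ A, ∀ w ∈ A, agreement G f f' a b = k →
      agreement G f f' w a = agreement G f f' w b → agreement G f f' w b ≠ k →
      a ≠ b → w ≠ a → w ≠ b → ¬ (F a < F w ∧ F w < F b)) →
      ConvexIn F A {y | Linked (agreement G f f') k A x y} := by
    intro F hF hkey a ha c hc' w hw h1 h2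
    change Linked _ _ _ _ _ at ha hc'
    by_contra hxw
    change ¬ Linked _ _ _ _ _ at hxw
    have hac : Linked _ _ _ _ _ := (hc.linked_symm ha).trans hc'
    obtain ⟨p, q, hp, hq, hpq, h3, h4⟩ := hac.exists_crossing h1 h2 (by
      intro b hb hbw
      rw [hF ((ha.trans hb).mem hx) hw hbw] at hb
      exact hxw (ha.trans hb))
    have hp := ha.trans hp
    have hq := ha.trans hq
    refine hkey p (hp.mem hx) q (hq.mem hx) w hw hpq ?_ ?_ ?_ ?_ ?_ ⟨h3, h4⟩
    · rw [hc.eq_of_linked hx hw hxw hp, hc.eq_of_linked hx hw hxw hq]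
    · exact hc.ne_of_not_linked hx hw hxw hq
    · rintro rfl; omega
    · rintro rfl; omega
    · rintro rfl; omega
  exact ⟨gen f h.injOn_left fun a ha b hb w hw h1 h2 h3 h4 h5 h6 =>
      (key a ha b hb w hw h1 h2 h3 h4 h5 h6).1,
    gen g h.injOn_right fun a ha b hb w hw h1 h2 h3 h4 h5 h6 =>
      (key a ha b hb w hw h1 h2 h3 h4 h5 h6).2⟩

/-- A common interval of two orderings of `A`, other than a singleton or `A`. -/
def HasCommonInterval (A : Set V) (f g : V → ℤ) : Prop :=
  ∃ M ⊆ A, M.Nontrivial ∧ M ≠ A ∧ ConvexIn f A M ∧ ConvexIn g A M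

/-- Some colour is disconnected, and its components are common intervals, hence singletons: this
colour does not occur. Absence of colour `0` or `1` is the claim. -/
theorem FnRealises.agree_or_disagree {G : SimpleGraph V} {A : Finset V} {f g f' g' : V → ℤ}
    (hA : 3 ≤ A.card) (h : FnRealises G A f g) (h' : FnRealises G A f' g')
    (hs : ¬ HasCommonInterval A f g) :
    (∀ a ∈ A, ∀ b ∈ A, G.Adj a b → (f a < f b ↔ f' a < f' b)) ∨
    (∀ a ∈ A, ∀ b ∈ A, G.Adj a b → ¬ (f a < f b ↔ f' a < f' b)) := by
  classical
  have hc := h.gallaiColoring h'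
  obtain ⟨k, U, hUA, ⟨p, hp⟩, hU', hcut⟩ := GallaiColoring.exists_cut A (by omega) hc
  have hno : ∀ a ∈ A, ∀ b ∈ A, a ≠ b → agreement G f f' a b ≠ k := by
    intro a ha b hb hab hk
    refine hs ⟨{y | Linked (agreement G f f') k A a y}, fun y hy => Linked.mem hy ha, ?_, ?_,
      agreement_convex h h' ha⟩
    · exact ⟨a, .refl, b, .single ⟨ha, hb, hk⟩, hab⟩
    · intro hall
      have hl : ∀ y ∈ A, Linked (agreement G f f') k A p y := fun y hy =>
        (hc.linked_symm ((Set.ext_iff.1 hall p).2 (hUA hp))).trans ((Set.ext_iff.1 hall y).2 hy)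
      have : ∀ b, Linked (agreement G f f') k A p b → b ∈ U := by
        intro b hb
        induction hb with
        | refl => exact hp
        | @tail b d _ hbd ih =>
          by_contra hd
          exact hcut b ih d hbd.2.1 hd hbd.2.2
      exact hU' (Finset.Subset.antisymm hUA fun y hy => this y (hl y hy))
  have hk : ∀ k : Fin 3, k = 0 ∨ k = 1 ∨ k = 2 := by decide
  rcases hk k with rfl | rfl | rfl
  · right
    intro a ha b hb hab hag
    exact hno a ha b hb hab.ne (by simp [agreement, hab, hag])
  · left
    intro a ha b hb hab
    by_contra hag
    exact hno a ha b hb hab.ne (by simp [agreement, hab, hag])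
  -- Without colour `2` the graph is complete on `A`, so `g` reverses `f`: the first two elements
  -- for `f` are the last two for `g` and form a nontrivial common interval, as `A` has at least
  -- three elements.
  · exfalso
    have hadj : ∀ a ∈ A, ∀ b ∈ A, a ≠ b → G.Adj a b := by
      intro a ha b hb hab
      by_contra hn
      exact hno a ha b hb hab (by simp [agreement, hn])
    obtain ⟨a, ha, hmin⟩ := A.exists_min_image f (Finset.card_pos.1 (by omega))
    have hcard := Finset.card_erase_of_mem ha
    obtain ⟨b, hb, hminb⟩ := (A.erase a).exists_min_image f (Finset.card_pos.1 (by omega))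
    have hbA := Finset.mem_of_mem_erase hb
    have hba := Finset.ne_of_mem_erase hb
    have hf : ∀ w ∈ A, w ≠ a → w ≠ b → f a < f b ∧ f b < f w := by
      intro w hw h1 h2
      have h3 := hminb w (Finset.mem_erase.2 ⟨h1, hw⟩)
      have h4 := hmin b hbA
      have h5 : f b ≠ f w := fun e => h2 (h.injOn_left hbA hw e).symm
      have h6 : f a ≠ f b := fun e => hba (h.injOn_left ha hbA e).symm
      omega
    have hg : ∀ w ∈ A, w ≠ a → w ≠ b → g w < g b ∧ g b < g a := by
      intro w hw h1 h2
      have h3 := hf w hw h1 h2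
      have h4 := (h.adj_iff a ha b hbA hba.symm).1 (hadj a ha b hbA hba.symm)
      have h5 := (h.adj_iff b hbA w hw h2.symm).1 (hadj b hbA w hw h2.symm)
      tauto
    refine hs ⟨{a, b}, by simp [Set.insert_subset_iff, ha, hbA], ⟨a, by simp, b, by simp, hba.symm⟩,
      ?_, ?_, ?_⟩
    · intro e
      have h1 : ({a, b} : Finset V) = A := Finset.coe_injective (by rw [Finset.coe_pair]; exact e)
      have h2 := Finset.card_le_two (a := a) (b := b)
      rw [h1] at h2
      omega
    · intro x hx y hy w hw h1 h2
      simp only [Set.mem_insert_iff, Set.mem_singleton_iff] at hx hy ⊢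
      by_contra! hne
      have := hf w hw hne.1 hne.2
      rcases hx with rfl | rfl <;> rcases hy with rfl | rfl <;> omega
    · intro x hx y hy w hw h1 h2
      simp only [Set.mem_insert_iff, Set.mem_singleton_iff] at hx hy ⊢
      by_contra! hne
      have := hg w hw hne.1 hne.2
      rcases hx with rfl | rfl <;> rcases hy with rfl | rfl <;> omega

theorem convexIn_neg {A z : Set V} {f : V → ℤ} :
    ConvexIn (fun a => - f a) A z ↔ ConvexIn f A z := by
  constructor <;> intro h a ha c hc b hb h1 h2
  · exact h c hc a ha b hb (by simpa using h2) (by simpa using h1)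
  · exact h c hc a ha b hb (by simpa using h2) (by simpa using h1)

theorem convexIn_congr {A z : Set V} {f g : V → ℤ} (hz : z ⊆ A)
    (h : ∀ a ∈ A, ∀ b ∈ A, a ≠ b → (f a < f b ↔ g a < g b)) :
    ConvexIn f A z ↔ ConvexIn g A z := by
  have h' : ∀ a ∈ A, ∀ b ∈ A, (f a < f b ↔ g a < g b) := by
    intro a ha b hb
    rcases eq_or_ne a b with rfl | hab
    · simp
    · exact h a ha b hb hab
  constructor <;> intro h a ha c hc b hb h1 h2
  · exact h a ha c hc b hb ((h' a (hz ha) b hb).2 h1) ((h' b hb c (hz hc)).2 h2)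
  · exact h a ha c hc b hb ((h' a (hz ha) b hb).1 h1) ((h' b hb c (hz hc)).1 h2)

theorem FnRealises.compl {G : SimpleGraph V} {A : Set V} {f g : V → ℤ}
    (h : FnRealises G A f g) : FnRealises Gᶜ A f fun a => - g a := by
  refine ⟨h.injOn_left, fun a ha b hb hab => h.injOn_right ha hb (neg_inj.1 hab), ?_⟩
  intro a ha b hb hab
  rw [SimpleGraph.compl_adj, h.adj_iff a ha b hb hab, neg_lt_neg_iff]
  have := h.lt_or_gt ha hb hab
  tauto

/-- A graph with a realiser without nontrivial common intervals has essentially one realiser. -/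
theorem FnRealises.convexIn_unique {G : SimpleGraph V} {A : Finset V} {f g f' g' : V → ℤ}
    (hA : 3 ≤ A.card) (h : FnRealises G A f g) (h' : FnRealises G A f' g')
    (hs : ¬ HasCommonInterval A f g) :
    (∀ z ⊆ (A : Set V), (ConvexIn f' A z ↔ ConvexIn f A z) ∧ (ConvexIn g' A z ↔ ConvexIn g A z)) ∨
    (∀ z ⊆ (A : Set V), (ConvexIn f' A z ↔ ConvexIn g A z) ∧
      (ConvexIn g' A z ↔ ConvexIn f A z)) := by
  have h1 := h.agree_or_disagree hA h' hs
  -- Reversing the second ordering realises the complement with the same intervals, so the dichotomy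
  -- also holds for the non-edges.
  have h2 := h.compl.agree_or_disagree hA h'.compl (by
    rintro ⟨M, h1, h2, h3, h4, h5⟩
    exact hs ⟨M, h1, h2, h3, h4, convexIn_neg.1 h5⟩)
  have facts : ∀ a ∈ A, ∀ b ∈ A, a ≠ b → (f a ≠ f b ∧ g a ≠ g b ∧ f' a ≠ f' b ∧ g' a ≠ g' b) ∧
      (G.Adj a b → (f a < f b ↔ g b < g a) ∧ (f' a < f' b ↔ g' b < g' a)) ∧
      (¬ G.Adj a b → ¬ (f a < f b ↔ g b < g a) ∧ ¬ (f' a < f' b ↔ g' b < g' a)) := by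
    intro a ha b hb hab
    have k1 := h.adj_iff a ha b hb hab
    have k2 := h'.adj_iff a ha b hb hab
    exact ⟨⟨fun e => hab (h.injOn_left ha hb e), fun e => hab (h.injOn_right ha hb e),
      fun e => hab (h'.injOn_left ha hb e), fun e => hab (h'.injOn_right ha hb e)⟩,
      fun e => ⟨k1.1 e, k2.1 e⟩, fun e => ⟨fun e' => e (k1.2 e'), fun e' => e (k2.2 e')⟩⟩
  replace h2 := h2.imp (fun k a ha b hb (hab : a ≠ b) hn => k a ha b hb ⟨hab, hn⟩)
    (fun k a ha b hb (hab : a ≠ b) hn => k a ha b hb ⟨hab, hn⟩)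
  have fin : ∀ {p p' : V → ℤ}, (∀ a ∈ A, ∀ b ∈ A, a ≠ b → (p' a < p' b ↔ p a < p b)) →
      ∀ z ⊆ (A : Set V), (ConvexIn p' A z ↔ ConvexIn p A z) :=
    fun hp z hz => convexIn_congr hz fun a ha b hb hab => hp a ha b hb hab
  have fin' : ∀ {p p' : V → ℤ}, (∀ a ∈ A, ∀ b ∈ A, a ≠ b → (p' a < p' b ↔ p b < p a)) →
      ∀ z ⊆ (A : Set V), (ConvexIn p' A z ↔ ConvexIn p A z) :=
    fun hp z hz => Iff.trans (convexIn_congr hz fun a ha b hb hab => by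
      rw [hp a ha b hb hab, neg_lt_neg_iff]) convexIn_neg
  -- Agreement on edges and on non-edges gives `f' = f` as orderings, and disagreement on both its
  -- reverse. In the mixed cases the two orderings are exchanged, up to reversal.
  rcases h1 with h1 | h1 <;> rcases h2 with h2 | h2
  · refine Or.inl fun z hz => ⟨fin (fun a ha b hb hab => ?_) z hz,
      fin (fun a ha b hb hab => ?_) z hz⟩ <;>
    · have k := facts a ha b hb hab
      by_cases e : G.Adj a b
      · have k1 := h1 a ha b hb e
        have k2 := k.2.1 e
        omega
      · have k1 := h2 a ha b hb hab e
        have k2 := k.2.2 e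
        omega
  · refine Or.inr fun z hz => ⟨fin' (fun a ha b hb hab => ?_) z hz,
      fin' (fun a ha b hb hab => ?_) z hz⟩ <;>
    · have k := facts a ha b hb hab
      by_cases e : G.Adj a b
      · have k1 := h1 a ha b hb e
        have k2 := k.2.1 e
        omega
      · have k1 := h2 a ha b hb hab e
        have k2 := k.2.2 e
        omega
  · refine Or.inr fun z hz => ⟨fin (fun a ha b hb hab => ?_) z hz,
      fin (fun a ha b hb hab => ?_) z hz⟩ <;>
    · have k := facts a ha b hb hab
      by_cases e : G.Adj a b
      · have k1 := h1 a ha b hb e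
        have k2 := k.2.1 e
        omega
      · have k1 := h2 a ha b hb hab e
        have k2 := k.2.2 e
        omega
  · refine Or.inl fun z hz => ⟨fin' (fun a ha b hb hab => ?_) z hz,
      fin' (fun a ha b hb hab => ?_) z hz⟩ <;>
    · have k := facts a ha b hb hab
      by_cases e : G.Adj a b
      · have k1 := h1 a ha b hb e
        have k2 := k.2.1 e
        omega
      · have k1 := h2 a ha b hb hab e
        have k2 := k.2.2 e
        omega

/-! ### Operations on chains of merges -/

theorem MergePath.append {P Q R : Set (Set V)} {W W' : Set (Set (Set V))} (h : MergePath P Q W)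
    (h' : MergePath Q R W') : MergePath P R (W ∪ W') := by
  induction h with
  | refl P => rwa [Set.union_eq_self_of_subset_left (Set.singleton_subset_iff.2 h'.start_mem)]
  | step hu hv huv _ ih =>
    rw [Set.insert_union]
    exact .step hu hv huv (ih h')

theorem MergePath.parts {P Q : Set (Set V)} {W : Set (Set (Set V))} (h : MergePath P Q W)
    (hP : IsParts P) {B : Set V} (hB : ∀ x ∈ P, x ⊆ B) :
    ∀ R ∈ W, IsParts R ∧ ∀ x ∈ R, x ⊆ B := by
  induction h with
  | refl P =>
    rintro R rfl
    exact ⟨hP, hB⟩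
  | @step P Q W u v hu hv huv _ ih =>
    rintro R (rfl | hR)
    · exact ⟨hP, hB⟩
    · refine ih (hP.merge hu hv) (fun x hx => ?_) R hR
      rcases mem_merge.1 hx with rfl | ⟨hx, -⟩
      · exact Set.union_subset (hB u hu) (hB v hv)
      · exact hB x hx

/-- The family of nonempty intersections of members of `P` with `B`. -/
def restrict (P : Set (Set V)) (B : Set V) : Set (Set V) :=
  {x | x.Nonempty ∧ ∃ y ∈ P, y ∩ B = x}

theorem restrict_merge_of_empty {P : Set (Set V)} {u v B : Set V} (hu : u ∈ P)
    (h : v ∩ B = ∅) : restrict (merge P u v) B = restrict P B := by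
  have huv : (u ∪ v) ∩ B = u ∩ B := by rw [Set.union_inter_distrib_right, h, Set.union_empty]
  ext x
  constructor
  · rintro ⟨hx, y, hy, rfl⟩
    rcases mem_merge.1 hy with rfl | ⟨hy, -⟩
    · exact ⟨hx, u, hu, huv.symm⟩
    · exact ⟨hx, y, hy, rfl⟩
  · rintro ⟨hx, y, hy, rfl⟩
    refine ⟨hx, ?_⟩
    by_cases hyu : y = u
    · exact ⟨u ∪ v, mem_merge.2 (Or.inl rfl), hyu ▸ huv⟩
    · refine ⟨y, mem_merge.2 (Or.inr ⟨hy, hyu, ?_⟩), rfl⟩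
      rintro rfl
      exact hx.ne_empty h

theorem merge_comm (P : Set (Set V)) (u v : Set V) : merge P u v = merge P v u := by
  rw [merge, merge, Set.union_comm, Set.pair_comm]

theorem restrict_merge {P : Set (Set V)} (hP : IsParts P) {u v B : Set V} (hu : u ∈ P)
    (hv : v ∈ P) (hu' : (u ∩ B).Nonempty) (hv' : (v ∩ B).Nonempty) :
    restrict (merge P u v) B = merge (restrict P B) (u ∩ B) (v ∩ B) := by
  ext x
  rw [mem_merge]
  constructor
  · rintro ⟨hx, y, hy, rfl⟩
    rcases mem_merge.1 hy with rfl | ⟨hy, h1, h2⟩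
    · exact Or.inl (Set.union_inter_distrib_right _ _ _)
    · obtain ⟨a, ha⟩ := hx
      refine Or.inr ⟨⟨⟨a, ha⟩, y, hy, rfl⟩, fun h => h1 ?_, fun h => h2 ?_⟩
      · exact hP.eq_of_mem hy hu ha.1 (h ▸ ha : a ∈ u ∩ B).1
      · exact hP.eq_of_mem hy hv ha.1 (h ▸ ha : a ∈ v ∩ B).1
  · rintro (rfl | ⟨⟨hx, y, hy, rfl⟩, h1, h2⟩)
    · exact ⟨hu'.mono Set.subset_union_left, u ∪ v, mem_merge.2 (Or.inl rfl),
        Set.union_inter_distrib_right _ _ _⟩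
    · refine ⟨hx, y, mem_merge.2 (Or.inr ⟨hy, ?_, ?_⟩), rfl⟩
      · rintro rfl; exact h1 rfl
      · rintro rfl; exact h2 rfl

/-- A merge in which one of the two parts misses `B` leaves the trace on `B` unchanged and is
dropped; the others restrict to merges. -/
theorem MergePath.restrict {P Q : Set (Set V)} {W : Set (Set (Set V))} (h : MergePath P Q W)
    (hP : IsParts P) (B : Set V) :
    ∃ W', MergePath (restrict P B) (restrict Q B) W' ∧
      ∀ R ∈ W', ∃ R₀ ∈ W, R = TwinWidthOne.restrict R₀ B := by
  induction h with
  | refl P =>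
    refine ⟨_, .refl _, ?_⟩
    rintro R rfl
    exact ⟨P, rfl, rfl⟩
  | @step P Q W u v hu hv huv hp ih =>
    obtain ⟨W', h1, h2⟩ := ih (hP.merge hu hv)
    have h3 : ∀ R ∈ W', ∃ R₀ ∈ insert P W, R = TwinWidthOne.restrict R₀ B := fun R hR => by
      obtain ⟨R₀, h, h'⟩ := h2 R hR
      exact ⟨R₀, Set.mem_insert_of_mem _ h, h'⟩
    rcases Set.eq_empty_or_nonempty (v ∩ B) with hv' | hv'
    · rw [restrict_merge_of_empty hu hv'] at h1
      exact ⟨W', h1, h3⟩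
    rcases Set.eq_empty_or_nonempty (u ∩ B) with hu' | hu'
    · rw [merge_comm, restrict_merge_of_empty hv hu'] at h1
      exact ⟨W', h1, h3⟩
    rw [restrict_merge hP hu hv hu' hv'] at h1
    refine ⟨_, .step ⟨hu', u, hu, rfl⟩ ⟨hv', v, hv, rfl⟩ (fun h => huv ?_) h1, ?_⟩
    · obtain ⟨a, ha⟩ := hu'
      exact hP.eq_of_mem hu hv ha.1 (h ▸ ha : a ∈ v ∩ B).1
    · rintro R (rfl | hR)
      · exact ⟨P, Set.mem_insert _ _, rfl⟩
      · exact h3 R hR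

theorem RedMatching.restrict {G : SimpleGraph V} {P : Set (Set V)} (h : RedMatching G P)
    (B : Set V) : RedMatching G (restrict P B) := by
  rintro _ ⟨-, x, hx, rfl⟩ _ ⟨-, y, hy, rfl⟩ _ ⟨-, z, hz, rfl⟩ hxy hxz h1 h2
  rw [h x hx y hy z hz (by rintro rfl; exact hxy rfl) (by rintro rfl; exact hxz rfl)
    (h1.mono Set.inter_subset_left Set.inter_subset_left)
    (h2.mono Set.inter_subset_left Set.inter_subset_left)]

/-- `A` can be merged from its singletons through families whose red graphs are matchings. -/
def Contractible (G : SimpleGraph V) (A : Set V) : Prop :=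
  ∃ W, MergePath (singletons A) {A} W ∧ ∀ R ∈ W, RedMatching G R

/-- Heredity is what allows the induction to pass to a common interval and to a quotient, the latter
being represented by an induced subgraph. -/
theorem Contractible.mono {G : SimpleGraph V} {A B : Set V} (h : Contractible G A)
    (hB : B.Nonempty) (hBA : B ⊆ A) : Contractible G B := by
  obtain ⟨W, h1, h2⟩ := h
  obtain ⟨W', h3, h4⟩ := h1.restrict (isParts_singletons A) B
  have e1 : restrict (singletons A) B = singletons B := by
    ext x
    constructor
    · rintro ⟨⟨b, hb⟩, _, ⟨a, ha, rfl⟩, rfl⟩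
      obtain ⟨rfl, hb⟩ := hb
      exact ⟨b, hb, by ext c; simp; rintro rfl; exact hb⟩
    · rintro ⟨a, ha, rfl⟩
      exact ⟨⟨a, rfl⟩, {a}, ⟨a, hBA ha, rfl⟩, by ext c; simp; rintro rfl; exact ha⟩
  have e2 : restrict {A} B = {B} := by
    ext x
    constructor
    · rintro ⟨-, _, rfl, rfl⟩
      exact Set.inter_eq_right.2 hBA
    · rintro rfl
      exact ⟨hB, A, rfl, Set.inter_eq_right.2 hBA⟩
  rw [e1, e2] at h3
  refine ⟨W', h3, fun R hR => ?_⟩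
  obtain ⟨R₀, hR₀, rfl⟩ := h4 R hR
  exact (h2 R₀ hR₀).restrict B

theorem MergePath.image {P Q : Set (Set V)} {W : Set (Set (Set V))} (h : MergePath P Q W)
    {B : Set V} (hB : ∀ x ∈ P, x ⊆ B) {φ : Set V → Set V} (hφ : ∀ x y, φ (x ∪ y) = φ x ∪ φ y)
    (hinj : ∀ x ⊆ B, ∀ y ⊆ B, φ x = φ y → x = y) :
    MergePath (φ '' P) (φ '' Q) ((φ '' ·) '' W) := by
  induction h with
  | refl P => rw [Set.image_singleton]; exact .refl _
  | @step P Q W u v hu hv huv _ ih =>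
    rw [Set.image_insert_eq]
    refine .step ⟨u, hu, rfl⟩ ⟨v, hv, rfl⟩ (fun h => huv (hinj u (hB u hu) v (hB v hv) h)) ?_
    have e : φ '' merge P u v = merge (φ '' P) (φ u) (φ v) := by
      ext x
      rw [mem_merge]
      constructor
      · rintro ⟨y, hy, rfl⟩
        rcases mem_merge.1 hy with rfl | ⟨hy, h1, h2⟩
        · exact Or.inl (hφ u v)
        · exact Or.inr ⟨⟨y, hy, rfl⟩, fun h => h1 (hinj y (hB y hy) u (hB u hu) h),
            fun h => h2 (hinj y (hB y hy) v (hB v hv) h)⟩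
      · rintro (rfl | ⟨⟨y, hy, rfl⟩, h1, h2⟩)
        · exact ⟨u ∪ v, mem_merge.2 (Or.inl rfl), hφ u v⟩
        · refine ⟨y, mem_merge.2 (Or.inr ⟨hy, ?_, ?_⟩), rfl⟩
          · rintro rfl; exact h1 rfl
          · rintro rfl; exact h2 rfl
    rw [← e]
    refine ih fun x hx => ?_
    rcases mem_merge.1 hx with rfl | ⟨hx, -⟩
    · exact Set.union_subset (hB u hu) (hB v hv)
    · exact hB x hx

theorem MergePath.union_right {P Q : Set (Set V)} {W : Set (Set (Set V))} (h : MergePath P Q W)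
    (hP : IsParts P) {B : Set V} (hB : ∀ x ∈ P, x ⊆ B) {S : Set (Set V)}
    (hS : ∀ x ∈ S, Disjoint x B) : MergePath (P ∪ S) (Q ∪ S) ((· ∪ S) '' W) := by
  induction h with
  | refl P => rw [Set.image_singleton]; exact .refl _
  | @step P Q W u v hu hv huv _ ih =>
    rw [Set.image_insert_eq]
    refine .step (Or.inl hu) (Or.inl hv) huv ?_
    have hn : ∀ x ∈ P, x ∉ S := by
      intro x hx hxS
      obtain ⟨a, ha⟩ := hP.nonempty x hx
      exact Set.disjoint_left.1 (hS x hxS) ha (hB x hx ha)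
    have e : merge (P ∪ S) u v = merge P u v ∪ S := by
      ext x
      have h1 : x ∈ S → x ≠ u ∧ x ≠ v := fun hx =>
        ⟨by rintro rfl; exact hn _ hu hx, by rintro rfl; exact hn _ hv hx⟩
      rw [mem_merge, Set.mem_union, Set.mem_union, mem_merge]
      tauto
    rw [e]
    refine ih (hP.merge hu hv) fun x hx => ?_
    rcases mem_merge.1 hx with rfl | ⟨hx, -⟩
    · exact Set.union_subset (hB u hu) (hB v hv)
    · exact hB x hx

/-! ### Substitution along a common interval -/

theorem FnRealises.mono {G : SimpleGraph V} {A B : Set V} {f g : V → ℤ} (h : FnRealises G A f g)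
    (hB : B ⊆ A) : FnRealises G B f g :=
  ⟨h.injOn_left.mono hB, h.injOn_right.mono hB,
    fun a ha b hb => h.adj_iff a (hB ha) b (hB hb)⟩

theorem ConvexIn.trans {f : V → ℤ} {A M x : Set V} (hx : ConvexIn f M x) (hM : ConvexIn f A M)
    (hxM : x ⊆ M) : ConvexIn f A x :=
  fun a ha c hc b hb h1 h2 => hx a ha c hc b (hM a (hxM ha) c (hxM hc) b hb h1 h2) h1 h2

theorem convexIn_singleton (f : V → ℤ) (A : Set V) (a : V) : ConvexIn f A {a} := by
  rintro _ rfl _ rfl b hb h1 h2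
  omega

open Classical in
/-- The map which sends all elements of `M` to `m` and fixes the other ones. -/
noncomputable def collapse (M : Set V) (m a : V) : V := if a ∈ M then m else a

/-- The set obtained from `x` by replacing `m`, if it belongs to `x`, by `M`. -/
def inflate (M : Set V) (m : V) (x : Set V) : Set V := {a | a ∈ x ∨ (a ∈ M ∧ m ∈ x)}

section Substitution

variable {G : SimpleGraph V} {A M : Set V} {f g : V → ℤ} {m : V}

theorem collapse_lt (hf : Set.InjOn f A) (hM : ConvexIn f A M) (hMA : M ⊆ A) (hm : m ∈ M)
    {a b : V} (ha : a ∈ A) (hb : b ∈ A) (hab : ¬ (a ∈ M ∧ b ∈ M)) (h : f a < f b) :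
    f (collapse M m a) < f (collapse M m b) := by
  unfold collapse
  by_cases h1 : a ∈ M <;> by_cases h2 : b ∈ M <;> simp only [h1, h2, if_true, if_false]
  · exact (hab ⟨h1, h2⟩).elim
  · by_contra! h3
    have h4 : f b ≠ f m := fun e => h2 (hf hb (hMA hm) e ▸ hm)
    exact h2 (hM a h1 m hm b hb h (lt_of_le_of_ne h3 h4))
  · by_contra! h3
    have h4 : f m ≠ f a := fun e => h1 (hf (hMA hm) ha e ▸ hm)
    exact h1 (hM m hm b h2 a ha (lt_of_le_of_ne h3 h4) h)
  · exact h

theorem collapse_lt_iff (hf : Set.InjOn f A) (hM : ConvexIn f A M) (hMA : M ⊆ A) (hm : m ∈ M)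
    {a b : V} (ha : a ∈ A) (hb : b ∈ A) (hab : ¬ (a ∈ M ∧ b ∈ M)) :
    f (collapse M m a) < f (collapse M m b) ↔ f a < f b := by
  refine ⟨fun h => ?_, collapse_lt hf hM hMA hm ha hb hab⟩
  by_contra! h'
  rcases h'.eq_or_lt with e | h'
  · rw [hf hb ha e] at h
    omega
  · have := collapse_lt hf hM hMA hm hb ha (fun k => hab k.symm) h'
    omega

theorem collapse_mem (hMA : M ⊆ A) (hm : m ∈ M) {a : V} (ha : a ∈ A) :
    collapse M m a ∈ A := by
  unfold collapse
  split_ifs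
  · exact hMA hm
  · exact ha

/-- A common interval is a module: an outside vertex compares in the same way, in both orderings,
with all elements of `M`. -/
theorem FnRealises.adj_collapse (h : FnRealises G A f g) (hf : ConvexIn f A M)
    (hg : ConvexIn g A M) (hMA : M ⊆ A) (hm : m ∈ M) {a b : V} (ha : a ∈ A) (hb : b ∈ A)
    (hab : ¬ (a ∈ M ∧ b ∈ M)) : G.Adj (collapse M m a) (collapse M m b) ↔ G.Adj a b := by
  rcases eq_or_ne a b with rfl | hne
  · simp
  have hne' : collapse M m a ≠ collapse M m b := by
    intro e
    have h1 := collapse_lt_iff h.injOn_left hf hMA hm ha hb hab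
    have h2 := collapse_lt_iff h.injOn_left hf hMA hm hb ha (fun k => hab k.symm)
    rw [e] at h1 h2
    have := (h.lt_or_gt ha hb hne).1
    omega
  rw [h.adj_iff _ (collapse_mem hMA hm ha) _ (collapse_mem hMA hm hb) hne',
    h.adj_iff a ha b hb hne, collapse_lt_iff h.injOn_left hf hMA hm ha hb hab,
    collapse_lt_iff h.injOn_right hg hMA hm hb ha (fun k => hab k.symm)]

theorem inflate_union (x y : Set V) : inflate M m (x ∪ y) = inflate M m x ∪ inflate M m y := by
  ext a
  simp only [inflate, Set.mem_ofPred_eq, Set.mem_union]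
  tauto

theorem eq_of_mem_subset {x : Set V} (hx : x ⊆ insert m (A \ M)) {a : V} (ha : a ∈ x)
    (haM : a ∈ M) : a = m := by
  rcases hx ha with h | h
  · exact h
  · exact (h.2 haM).elim

theorem mem_inflate {x : Set V} (hx : x ⊆ insert m (A \ M)) {a : V} :
    a ∈ inflate M m x ↔ collapse M m a ∈ x := by
  unfold collapse inflate
  split_ifs with h
  · exact ⟨fun k => k.elim (fun k => eq_of_mem_subset hx k h ▸ k) (·.2), fun k => Or.inr ⟨h, k⟩⟩
  · exact ⟨fun k => k.elim id fun k => (h k.1).elim, Or.inl⟩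

theorem inflate_injective {x y : Set V} (hx : x ⊆ insert m (A \ M))
    (hy : y ⊆ insert m (A \ M)) (h : inflate M m x = inflate M m y) : x = y := by
  have key : ∀ x y : Set V, x ⊆ insert m (A \ M) → inflate M m x = inflate M m y → x ⊆ y := by
    intro x y hx h a ha
    rcases (h ▸ Or.inl ha : a ∈ inflate M m y) with k | ⟨k, k'⟩
    · exact k
    · rwa [eq_of_mem_subset hx ha k]
  exact (key x y hx h).antisymm (key y x hy h.symm)

theorem ConvexIn.inflate {x : Set V} (h : ConvexIn f (insert m (A \ M)) x)
    (hf : Set.InjOn f A) (hM : ConvexIn f A M) (hMA : M ⊆ A) (hm : m ∈ M)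
    (hx : x ⊆ insert m (A \ M)) : ConvexIn f A (inflate M m x) := by
  intro a ha c hc b hb h1 h2
  by_cases hbm : b ∈ M ∧ m ∈ x
  · exact Or.inr hbm
  have hsub : insert m (A \ M) ⊆ A := Set.insert_subset (hMA hm) Set.sdiff_subset
  have hxA : ∀ a ∈ TwinWidthOne.inflate M m x, a ∈ A := by
    rintro a (h | h)
    · exact hsub (hx h)
    · exact hMA h.1
  have hmx : ∀ a ∈ TwinWidthOne.inflate M m x, a ∈ M → m ∈ x := by
    rintro a (h | h) h'
    · exact eq_of_mem_subset hx h h' ▸ h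
    · exact h.2
  have hbB : collapse M m b ∈ insert m (A \ M) := by
    unfold collapse
    split_ifs with h
    · exact Or.inl rfl
    · exact Or.inr ⟨hb, h⟩
  rw [mem_inflate hx]
  refine h _ ((mem_inflate hx).1 ha) _ ((mem_inflate hx).1 hc) _ hbB
    (collapse_lt hf hM hMA hm (hxA a ha) hb (fun k => hbm ⟨k.2, hmx a ha k.1⟩) h1)
    (collapse_lt hf hM hMA hm hb (hxA c hc) (fun k => hbm ⟨k.1, hmx c hc k.2⟩) h2)

/-- Disjointness ensures that at most one of the two sets contains `m`, so collapsing never compares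
two elements of `M` and preserves every adjacency between them. -/
theorem FnRealises.mixed_of_inflate (h : FnRealises G A f g) (hf : ConvexIn f A M)
    (hg : ConvexIn g A M) (hMA : M ⊆ A) (hm : m ∈ M) {x y : Set V}
    (hx : x ⊆ insert m (A \ M)) (hy : y ⊆ insert m (A \ M)) (hxy : Disjoint x y)
    (hmix : Mixed G (inflate M m x) (inflate M m y)) : Mixed G x y := by
  have hsub : insert m (A \ M) ⊆ A := Set.insert_subset (hMA hm) Set.sdiff_subset
  have hA : ∀ {x : Set V}, x ⊆ insert m (A \ M) → ∀ a ∈ inflate M m x, a ∈ A := by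
    rintro x hx a (h | h)
    · exact hsub (hx h)
    · exact hMA h.1
  have hmx : ∀ {x : Set V}, x ⊆ insert m (A \ M) → ∀ a ∈ inflate M m x, a ∈ M → m ∈ x := by
    rintro x hx a (h | h) h'
    · exact eq_of_mem_subset hx h h' ▸ h
    · exact h.2
  have key : ∀ a ∈ inflate M m x, ∀ b ∈ inflate M m y,
      (G.Adj (collapse M m a) (collapse M m b) ↔ G.Adj a b) := fun a ha b hb =>
    h.adj_collapse hf hg hMA hm (hA hx a ha) (hA hy b hb) fun k =>
      Set.disjoint_left.1 hxy (hmx hx a ha k.1) (hmx hy b hb k.2)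
  obtain ⟨⟨a, ha, b, hb, h1⟩, c, hc, d, hd, h2⟩ := hmix
  exact ⟨⟨_, (mem_inflate hx).1 ha, _, (mem_inflate hy).1 hb, (key a ha b hb).2 h1⟩,
    _, (mem_inflate hx).1 hc, _, (mem_inflate hy).1 hd, fun k => h2 ((key c hc d hd).1 k)⟩

/-- Sequences for a common interval `M` and for the quotient by `M` can be combined. -/
theorem exists_path_of_commonInterval (h : FnRealises G A f g) (hf : ConvexIn f A M)
    (hg : ConvexIn g A M) (hMA : M ⊆ A) (hm : m ∈ M) {W W' : Set (Set (Set V))}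
    (hW : MergePath (singletons M) {M} W)
    (hWr : ∀ R ∈ W, RedMatching G R ∧ AdaptedTo G M f g R)
    (hW' : MergePath (singletons (insert m (A \ M))) {insert m (A \ M)} W')
    (hWr' : ∀ R ∈ W', RedMatching G R ∧ AdaptedTo G (insert m (A \ M)) f g R) :
    ∃ W'', MergePath (singletons A) {A} W'' ∧
      ∀ R ∈ W'', RedMatching G R ∧ AdaptedTo G A f g R := by
  have hsing : ∀ B : Set V, ∀ x ∈ singletons B, x ⊆ B := by
    rintro B _ ⟨a, ha, rfl⟩
    exact Set.singleton_subset_iff.2 ha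
  have h1 := hW.union_right (isParts_singletons M) (hsing M) (S := singletons (A \ M)) (by
    rintro _ ⟨a, ha, rfl⟩
    exact Set.disjoint_singleton_left.2 ha.2)
  have h2 := hW'.image (hsing _) (φ := inflate M m) inflate_union
    (fun x hx y hy e => inflate_injective hx hy e)
  have e1 : singletons M ∪ singletons (A \ M) = singletons A := by
    rw [singletons, singletons, singletons, ← Set.image_union, Set.union_sdiff_cancel hMA]
  have em : inflate M m {m} = M := by
    ext a
    simp only [inflate, Set.mem_ofPred_eq, Set.mem_singleton_iff, and_true]
    exact ⟨fun k => k.elim (fun k => k ▸ hm) id, Or.inr⟩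
  have ea : ∀ a ∈ A \ M, inflate M m {a} = {a} := by
    intro a ha
    ext b
    simp only [inflate, Set.mem_ofPred_eq, Set.mem_singleton_iff]
    refine ⟨fun k => k.elim id fun k => ?_, Or.inl⟩
    exact (ha.2 (k.2 ▸ hm)).elim
  have e2 : inflate M m '' singletons (insert m (A \ M)) = {M} ∪ singletons (A \ M) := by
    rw [singletons, singletons, Set.image_insert_eq, Set.image_insert_eq, em, Set.image_image,
      Set.insert_eq]
    congr 1
    exact Set.image_congr ea
  have e3 : inflate M m (insert m (A \ M)) = A := by
    ext a
    simp only [inflate, Set.mem_ofPred_eq, Set.mem_insert_iff, Set.mem_sdiff, true_or, and_true]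
    constructor
    · rintro ((rfl | k) | k)
      · exact hMA hm
      · exact k.1
      · exact hMA k
    · intro k
      by_cases haM : a ∈ M
      · exact Or.inr haM
      · exact Or.inl (Or.inr ⟨k, haM⟩)
  rw [e1] at h1
  rw [e2, Set.image_singleton, e3] at h2
  refine ⟨_, h1.append h2, ?_⟩
  rintro _ (⟨R, hR, rfl⟩ | ⟨R, hR, rfl⟩)
  · obtain ⟨hRp, hRM⟩ := hW.parts (isParts_singletons M) (hsing M) R hR
    obtain ⟨hr, had⟩ := hWr R hR
    -- While `M` is being contracted, the outside singletons create no red edge because `M` is a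
    -- module.
    have nm : ∀ x ∈ R ∪ singletons (A \ M), ∀ y ∈ singletons (A \ M), ¬ Mixed G x y := by
      rintro x (hx | ⟨a, ha, rfl⟩) _ ⟨w, hw, rfl⟩
      · have key : ∀ a ∈ x, (G.Adj (collapse M m a) (collapse M m w) ↔ G.Adj a w) := fun a ha =>
          h.adj_collapse hf hg hMA hm (hMA (hRM x hx ha)) hw.1 fun k => hw.2 k.2
        rintro ⟨⟨a, ha, _, rfl, k1⟩, c, hc, _, rfl, k2⟩
        rw [← key a ha] at k1
        rw [← key c hc] at k2
        simp only [collapse, hRM x hx ha, hRM x hx hc, if_true] at k1 k2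
        exact k2 k1
      · exact not_mixed_singletons G a w
    have nm' : ∀ x ∈ R ∪ singletons (A \ M), ∀ y ∈ R ∪ singletons (A \ M), Mixed G x y →
        x ∈ R ∧ y ∈ R := fun x hx y hy hxy =>
      ⟨hx.resolve_right fun k => nm y hy x k hxy.symm, hy.resolve_right fun k => nm x hx y k hxy⟩
    refine ⟨?_, ?_, ?_⟩
    · intro x hx y hy z hz hxy hxz k1 k2
      exact hr x (nm' x hx y hy k1).1 y (nm' x hx y hy k1).2 z (nm' x hx z hz k2).2 hxy hxz k1 k2
    · rintro x (hx | ⟨a, ha, rfl⟩)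
      · exact (had.vertex x hx).imp (·.trans hf (hRM x hx)) (·.trans hg (hRM x hx))
      · exact Or.inl (convexIn_singleton f A a)
    · intro x hx y hy hxy k
      obtain ⟨hx, hy⟩ := nm' x hx y hy k
      have u := Set.union_subset (hRM x hx) (hRM y hy)
      exact (had.red x hx y hy hxy k).imp
        (fun k => ⟨k.1.trans hf u, k.2.1.trans hg (hRM x hx), k.2.2.trans hg (hRM y hy)⟩)
        fun k => ⟨k.1.trans hg u, k.2.1.trans hf (hRM x hx), k.2.2.trans hf (hRM y hy)⟩
  · obtain ⟨hRp, hRM⟩ := hW'.parts (isParts_singletons _) (hsing _) R hR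
    obtain ⟨hr, had⟩ := hWr' R hR
    have mx : ∀ x ∈ R, ∀ y ∈ R, inflate M m x ≠ inflate M m y →
        Mixed G (inflate M m x) (inflate M m y) → x ≠ y ∧ Mixed G x y := by
      intro x hx y hy hxy k
      have hne : x ≠ y := by rintro rfl; exact hxy rfl
      exact ⟨hne, h.mixed_of_inflate hf hg hMA hm (hRM x hx) (hRM y hy)
        (hRp.disjoint x hx y hy hne) k⟩
    refine ⟨?_, ?_, ?_⟩
    · rintro _ ⟨x, hx, rfl⟩ _ ⟨y, hy, rfl⟩ _ ⟨z, hz, rfl⟩ hxy hxz k1 k2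
      obtain ⟨n1, k1⟩ := mx x hx y hy hxy k1
      obtain ⟨n2, k2⟩ := mx x hx z hz hxz k2
      rw [hr x hx y hy z hz n1 n2 k1 k2]
    · rintro _ ⟨x, hx, rfl⟩
      exact (had.vertex x hx).imp (·.inflate h.injOn_left hf hMA hm (hRM x hx))
        (·.inflate h.injOn_right hg hMA hm (hRM x hx))
    · rintro _ ⟨x, hx, rfl⟩ _ ⟨y, hy, rfl⟩ hxy k
      obtain ⟨n1, k1⟩ := mx x hx y hy hxy k
      have u := Set.union_subset (hRM x hx) (hRM y hy)
      rw [← inflate_union]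
      exact (had.red x hx y hy n1 k1).imp
        (fun k => ⟨k.1.inflate h.injOn_left hf hMA hm u,
          k.2.1.inflate h.injOn_right hg hMA hm (hRM x hx),
          k.2.2.inflate h.injOn_right hg hMA hm (hRM y hy)⟩)
        fun k => ⟨k.1.inflate h.injOn_right hg hMA hm u,
          k.2.1.inflate h.injOn_left hf hMA hm (hRM x hx),
          k.2.2.inflate h.injOn_left hf hMA hm (hRM y hy)⟩

end Substitution

/-! ### A sequence for every realiser -/

theorem convexIn_of_card_le {f : V → ℤ} {A : Finset V} (hA : A.card ≤ 2) {z : Set V}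
    (hz : z ⊆ A) : ConvexIn f A z := by
  classical
  intro a ha c hc b hb h1 h2
  have h3 : ({a, b, c} : Finset V) ⊆ A := by
    intro x hx
    simp only [Finset.mem_insert, Finset.mem_singleton] at hx
    rcases hx with rfl | rfl | rfl
    · exact hz ha
    · exact hb
    · exact hz hc
  have h4 := Finset.card_le_card h3
  rw [Finset.card_eq_three.2 ⟨a, b, c, by rintro rfl; omega, by rintro rfl; omega,
    by rintro rfl; omega, rfl⟩] at h4
  omega

/-- Every realiser of a contractible graph is adapted to some sequence. -/
theorem FnRealises.exists_path {G : SimpleGraph V} {f g : V → ℤ} (A : Finset V)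
    (hA : A.Nonempty) (h : FnRealises G A f g) (hc : Contractible G (A : Set V)) :
    ∃ W, MergePath (singletons (A : Set V)) {(A : Set V)} W ∧
      ∀ R ∈ W, RedMatching G R ∧ AdaptedTo G A f g R := by
  classical
  induction A using Finset.strongInduction with
  | H A ih =>
  have hparts : ∀ {W}, MergePath (singletons (A : Set V)) {(A : Set V)} W → ∀ R ∈ W, ∀ x ∈ R,
      x ⊆ (A : Set V) := fun hW R hR => (hW.parts (isParts_singletons _) (by
      rintro _ ⟨a, ha, rfl⟩
      exact Set.singleton_subset_iff.2 ha) R hR).2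
  by_cases hcard : A.card ≤ 2
  · obtain ⟨W, hW, hr⟩ := hc
    have hp := hparts hW
    refine ⟨W, hW, fun R hR => ⟨hr R hR, fun x hx => ?_, fun x hx y hy _ _ => ?_⟩⟩
    · exact Or.inl (convexIn_of_card_le hcard (hp R hR x hx))
    · exact Or.inl ⟨convexIn_of_card_le hcard (Set.union_subset (hp R hR x hx) (hp R hR y hy)),
        convexIn_of_card_le hcard (hp R hR x hx), convexIn_of_card_le hcard (hp R hR y hy)⟩
  by_cases hs : HasCommonInterval A f g
  · obtain ⟨M, hMA, ⟨m, hm, m', hm', hne⟩, hM, hf, hg⟩ := hs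
    lift M to Finset V using A.finite_toSet.subset hMA
    have hsub : insert m ((A : Set V) \ M) ⊆ (A : Set V) :=
      Set.insert_subset (hMA hm) Set.sdiff_subset
    obtain ⟨W, hW, hWr⟩ := ih M
      ((Finset.coe_subset.1 hMA).ssubset_of_ne fun e => hM (by rw [e]))
      ⟨m, hm⟩ (h.mono hMA) (hc.mono ⟨m, hm⟩ hMA)
    -- The quotient keeps the representative `m` of `M`; the second element `m'` is lost, so the set
    -- is strictly smaller.
    obtain ⟨W', hW', hWr'⟩ := ih (insert m (A \ M)) (by
        refine Finset.ssubset_iff_subset_ne.2 ⟨by exact_mod_cast hsub, fun e => ?_⟩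
        have h1 : m' ∈ insert m (A \ M) := by rw [e]; exact hMA hm'
        rw [Finset.mem_insert, Finset.mem_sdiff] at h1
        rcases h1 with h1 | h1
        · exact hne h1.symm
        · exact h1.2 hm')
      ⟨m, by simp⟩ (h.mono (by push_cast; exact hsub)) (hc.mono ⟨m, by simp⟩ (by
        push_cast; exact hsub))
    rw [Finset.coe_insert, Finset.coe_sdiff] at hW' hWr'
    exact exists_path_of_commonInterval h hf hg hMA hm hW hWr hW' hWr'
  -- The given chain works unchanged: it has an adapted realiser, and uniqueness transfers the
  -- intervals to `f` and `g`, possibly exchanged. Both properties are symmetric in the two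
  -- orderings.
  · obtain ⟨W, hW, hr⟩ := hc
    have hp := hparts hW
    obtain ⟨f', g', h', had⟩ := hW.exists_adapted hr
    refine ⟨W, hW, fun R hR => ⟨hr R hR, ?_, ?_⟩⟩
    · intro x hx
      have := (had R hR).vertex x hx
      rcases h.convexIn_unique (by omega) h' hs with k | k
      · rwa [(k x (hp R hR x hx)).1, (k x (hp R hR x hx)).2] at this
      · rw [(k x (hp R hR x hx)).1, (k x (hp R hR x hx)).2] at this
        exact this.symm
    · intro x hx y hy hxy hm
      have := (had R hR).red x hx y hy hxy hm
      have hu := Set.union_subset (hp R hR x hx) (hp R hR y hy)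
      rcases h.convexIn_unique (by omega) h' hs with k | k <;>
        rw [(k x (hp R hR x hx)).1, (k x (hp R hR x hx)).2, (k y (hp R hR y hy)).1,
          (k y (hp R hR y hy)).2, (k _ hu).1, (k _ hu).2] at this
      · exact this
      · exact this.symm

/-! ### Trigraphs determined by their parts -/

/-- The trigraph on a family `P` of sets: black edges join completely adjacent sets
and red edges join mixed sets. -/
def Trigraph.ofParts (G : SimpleGraph V) (P : Set (Set V)) : Trigraph (Set V) where
  verts := P
  black :=
    { Adj := fun x y => x ∈ P ∧ y ∈ P ∧ x ≠ y ∧ ∀ a ∈ x, ∀ b ∈ y, G.Adj a b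
      symm := ⟨fun _ _ h => ⟨h.2.1, h.1, h.2.2.1.symm, fun a ha b hb => (h.2.2.2 b hb a ha).symm⟩⟩
      loopless := ⟨fun _ h => h.2.2.1 rfl⟩ }
  red :=
    { Adj := fun x y => x ∈ P ∧ y ∈ P ∧ x ≠ y ∧ Mixed G x y
      symm := ⟨fun _ _ h => ⟨h.2.1, h.1, h.2.2.1.symm, h.2.2.2.symm⟩⟩
      loopless := ⟨fun _ h => h.2.2.1 rfl⟩ }
  black_mem := fun h => h.1
  red_mem := fun h => h.1
  disjoint := by
    rw [SimpleGraph.disjoint_left]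
    rintro x y ⟨-, -, -, h⟩ ⟨-, -, -, -, a, ha, b, hb, h'⟩
    exact h' (h a ha b hb)

theorem ofGraph_eq_ofParts (G : SimpleGraph V) :
    ofGraph G = Trigraph.ofParts G (singletons Set.univ) := by
  ext x y
  · simp [ofGraph, Trigraph.ofParts, singletons]
  · constructor
    · rintro ⟨hne, a, b, h, rfl, rfl⟩
      refine ⟨⟨a, trivial, rfl⟩, ⟨b, trivial, rfl⟩, hne, ?_⟩
      rintro _ rfl _ rfl
      exact h
    · rintro ⟨⟨a, -, rfl⟩, ⟨b, -, rfl⟩, hne, h⟩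
      exact ⟨hne, a, b, h a rfl b rfl, rfl, rfl⟩
  · constructor
    · intro h
      exact h.elim
    · rintro ⟨⟨a, -, rfl⟩, ⟨b, -, rfl⟩, -, h⟩
      exact (not_mixed_singletons G a b h).elim

/-- For nonempty parts, being adjacent in the underlying graph means having at least one edge
between them. The contraction rule thus gives a red edge exactly when the union has both an edge and
a non-edge to the third part. -/
theorem contract_ofParts {G : SimpleGraph V} {P : Set (Set V)} (hP : IsParts P) {u v : Set V}
    (hu : u ∈ P) (hv : v ∈ P) :
    (Trigraph.ofParts G P).contract u v (u ∪ v) = Trigraph.ofParts G (merge P u v) := by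
  have hne : ∀ x ∈ P, x ≠ u → x ≠ v → x ≠ u ∪ v := by
    rintro x hx h1 - rfl
    exact h1 (hP.eq_of_subset hu hx Set.subset_union_left).symm
  have mem : ∀ x, x ∈ P \ {u, v, u ∪ v} ↔ x ∈ merge P u v ∧ x ≠ u ∪ v := by
    intro x
    have := hne x
    rw [mem_merge]
    simp only [Set.mem_sdiff, Set.mem_insert_iff, Set.mem_singleton_iff]
    tauto
  have memP : ∀ x ∈ P \ {u, v, u ∪ v}, x ∈ P ∧ u ≠ x ∧ v ≠ x := by
    rintro x ⟨h1, h2⟩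
    simp only [Set.mem_insert_iff, Set.mem_singleton_iff, not_or] at h2
    exact ⟨h1, fun e => h2.1 e.symm, fun e => h2.2.1 e.symm⟩
  have hmu : u ∪ v ∈ merge P u v := mem_merge.2 (Or.inl rfl)
  have black_iff : ∀ z ∈ P \ {u, v, u ∪ v},
      ((Trigraph.ofParts G P).black.Adj u z ∧ (Trigraph.ofParts G P).black.Adj v z ↔
        ∀ a ∈ u ∪ v, ∀ b ∈ z, G.Adj a b) := by
    intro z hz
    obtain ⟨hz, h1, h2⟩ := memP z hz
    constructor
    · rintro ⟨⟨-, -, -, h3⟩, -, -, -, h4⟩ a (ha | ha) b hb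
      · exact h3 a ha b hb
      · exact h4 a ha b hb
    · intro h
      exact ⟨⟨hu, hz, h1, fun a ha => h a (Or.inl ha)⟩, hv, hz, h2, fun a ha => h a (Or.inr ha)⟩
  have und_iff : ∀ x ∈ P, ∀ z ∈ P, x ≠ z →
      ((Trigraph.ofParts G P).underlying.Adj x z ↔ ∃ a ∈ x, ∃ b ∈ z, G.Adj a b) := by
    intro x hx z hz hxz
    constructor
    · rintro (⟨-, -, -, h⟩ | ⟨-, -, -, h, -⟩)
      · obtain ⟨a, ha⟩ := hP.nonempty x hx
        obtain ⟨b, hb⟩ := hP.nonempty z hz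
        exact ⟨a, ha, b, hb, h a ha b hb⟩
      · exact h
    · intro h
      by_cases h' : ∀ a ∈ x, ∀ b ∈ z, G.Adj a b
      · exact Or.inl ⟨hx, hz, hxz, h'⟩
      · push Not at h'
        exact Or.inr ⟨hx, hz, hxz, h, h'⟩
  have red_iff : ∀ z ∈ P \ {u, v, u ∪ v},
      (((Trigraph.ofParts G P).underlying.Adj u z ∨ (Trigraph.ofParts G P).underlying.Adj v z) ∧
        ¬ ((Trigraph.ofParts G P).black.Adj u z ∧ (Trigraph.ofParts G P).black.Adj v z) ↔
        Mixed G (u ∪ v) z) := by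
    intro z hz
    rw [black_iff z hz]
    obtain ⟨hz, h1, h2⟩ := memP z hz
    rw [und_iff u hu z hz h1, und_iff v hv z hz h2, Mixed]
    push Not
    refine and_congr_left fun _ => ⟨?_, ?_⟩
    · rintro (⟨a, ha, h⟩ | ⟨a, ha, h⟩)
      · exact ⟨a, Or.inl ha, h⟩
      · exact ⟨a, Or.inr ha, h⟩
    · rintro ⟨a, ha | ha, h⟩
      · exact Or.inl ⟨a, ha, h⟩
      · exact Or.inr ⟨a, ha, h⟩
  have hb : ∀ y ∈ P \ {u, v, u ∪ v}, ∀ z ∈ P \ {u, v, u ∪ v},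
      ((Trigraph.ofParts G P).black.Adj y z ↔ y ≠ z ∧ ∀ a ∈ y, ∀ b ∈ z, G.Adj a b) :=
    fun y hy z hz => ⟨fun h => h.2.2, fun h => ⟨hy.1, hz.1, h⟩⟩
  have hr : ∀ y ∈ P \ {u, v, u ∪ v}, ∀ z ∈ P \ {u, v, u ∪ v},
      ((Trigraph.ofParts G P).red.Adj y z ↔ y ≠ z ∧ Mixed G y z) :=
    fun y hy z hz => ⟨fun h => h.2.2, fun h => ⟨hy.1, hz.1, h⟩⟩
  ext y z
  · rfl
  · simp only [Trigraph.contract, SimpleGraph.fromRel_adj]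
    constructor
    · rintro ⟨hyz, (⟨hy, hz, h⟩ | ⟨rfl, hz, h⟩) | (⟨hz, hy, h⟩ | ⟨rfl, hy, h⟩)⟩
      · exact ⟨((mem y).1 hy).1, ((mem z).1 hz).1, (hb y hy z hz).1 h⟩
      · exact ⟨hmu, ((mem z).1 hz).1, hyz, (black_iff z hz).1 h⟩
      · exact ⟨((mem y).1 hy).1, ((mem z).1 hz).1, (hb y hy z hz).1 h.symm⟩
      · exact ⟨((mem y).1 hy).1, hmu, hyz, fun a ha b hb' =>
          ((black_iff y hy).1 h b hb' a ha).symm⟩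
    · rintro ⟨hy, hz, hyz, h⟩
      refine ⟨hyz, ?_⟩
      by_cases h1 : y = u ∪ v
      · subst h1
        have hz' := (mem z).2 ⟨hz, hyz.symm⟩
        exact Or.inl (Or.inr ⟨rfl, hz', (black_iff z hz').2 h⟩)
      · have hy' := (mem y).2 ⟨hy, h1⟩
        by_cases h2 : z = u ∪ v
        · subst h2
          exact Or.inr (Or.inr ⟨rfl, hy', (black_iff y hy').2 fun a ha b hb' =>
            (h b hb' a ha).symm⟩)
        · have hz' := (mem z).2 ⟨hz, h2⟩
          exact Or.inl (Or.inl ⟨hy', hz', (hb y hy' z hz').2 ⟨hyz, h⟩⟩)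
  · simp only [Trigraph.contract, SimpleGraph.fromRel_adj]
    constructor
    · rintro ⟨hyz, (⟨hy, hz, h⟩ | ⟨rfl, hz, h⟩) | (⟨hz, hy, h⟩ | ⟨rfl, hy, h⟩)⟩
      · exact ⟨((mem y).1 hy).1, ((mem z).1 hz).1, (hr y hy z hz).1 h⟩
      · exact ⟨hmu, ((mem z).1 hz).1, hyz, (red_iff z hz).1 h⟩
      · exact ⟨((mem y).1 hy).1, ((mem z).1 hz).1, (hr y hy z hz).1 h.symm⟩
      · exact ⟨((mem y).1 hy).1, hmu, hyz, ((red_iff y hy).1 h).symm⟩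
    · rintro ⟨hy, hz, hyz, h⟩
      refine ⟨hyz, ?_⟩
      by_cases h1 : y = u ∪ v
      · subst h1
        have hz' := (mem z).2 ⟨hz, hyz.symm⟩
        exact Or.inl (Or.inr ⟨rfl, hz', (red_iff z hz').2 h⟩)
      · have hy' := (mem y).2 ⟨hy, h1⟩
        by_cases h2 : z = u ∪ v
        · subst h2
          exact Or.inr (Or.inr ⟨rfl, hy', (red_iff y hy').2 h.symm⟩)
        · have hz' := (mem z).2 ⟨hz, h2⟩
          exact Or.inl (Or.inl ⟨hy', hz', (hr y hy' z hz').2 ⟨hyz, h⟩⟩)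

theorem isDTrigraph_ofParts {G : SimpleGraph V} {P : Set (Set V)} :
    (Trigraph.ofParts G P).IsDTrigraph 1 ↔ RedMatching G P := by
  constructor
  · intro h x hx y hy z hz hxy hxz h1 h2
    have := Set.encard_le_one_iff.1 (by simpa using h x hx)
    exact this y z ⟨hx, hy, hxy, h1⟩ ⟨hx, hz, hxz, h2⟩
  · intro h x hx
    rw [Nat.cast_one, Set.encard_le_one_iff]
    rintro y z ⟨-, hy, hxy, h1⟩ ⟨-, hz, hxz, h2⟩
    exact h x hx y hy z hz hxy hxz h1 h2

/-! ### Chains of merges and contraction sequences -/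

theorem MergePath.sUnion_eq {P Q : Set (Set V)} {W : Set (Set (Set V))} (h : MergePath P Q W) :
    ⋃₀ P = ⋃₀ Q := by
  induction h with
  | refl P => rfl
  | @step P Q W u v hu hv huv _ ih =>
    rw [← ih]
    ext a
    constructor
    · rintro ⟨x, hx, ha⟩
      by_cases h1 : x = u
      · exact ⟨u ∪ v, mem_merge.2 (Or.inl rfl), Or.inl (h1 ▸ ha)⟩
      by_cases h2 : x = v
      · exact ⟨u ∪ v, mem_merge.2 (Or.inl rfl), Or.inr (h2 ▸ ha)⟩
      exact ⟨x, mem_merge.2 (Or.inr ⟨hx, h1, h2⟩), ha⟩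
    · rintro ⟨x, hx, ha⟩
      rcases mem_merge.1 hx with rfl | ⟨hx, -⟩
      · exact ha.elim (fun ha => ⟨u, hu, ha⟩) fun ha => ⟨v, hv, ha⟩
      · exact ⟨x, hx, ha⟩

theorem sUnion_singletons (A : Set V) : ⋃₀ singletons A = A := by
  ext a
  constructor
  · rintro ⟨_, ⟨b, hb, rfl⟩, rfl⟩
    exact hb
  · intro ha
    exact ⟨{a}, ⟨a, ha, rfl⟩, rfl⟩

theorem ncard_merge [Finite V] {P : Set (Set V)} (hP : IsParts P) {u v : Set V} (hu : u ∈ P)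
    (hv : v ∈ P) (huv : u ≠ v) : (merge P u v).ncard + 1 = P.ncard := by
  have h1 : u ∪ v ∉ P \ {u, v} := by
    rintro ⟨h, h'⟩
    exact h' (Or.inl (hP.eq_of_subset hu h Set.subset_union_left).symm)
  have h2 : ({u, v} : Set (Set V)) ⊆ P := by
    rintro x (rfl | rfl)
    · exact hu
    · exact hv
  have h3 := Set.ncard_sdiff_add_ncard_of_subset h2
  rw [Set.ncard_pair huv] at h3
  rw [merge, Set.ncard_insert_of_notMem h1]
  omega

theorem MergePath.exists_sequence [Finite V] {P Q : Set (Set V)} {W : Set (Set (Set V))}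
    (h : MergePath P Q W) (hP : IsParts P) {A : Set V} (hQ : Q = {A}) :
    ∃ F : ℕ → Set (Set V), F P.ncard = P ∧ F 1 = {A} ∧ 1 ≤ P.ncard ∧
      (∀ i, 1 < i → i ≤ P.ncard → ∃ u ∈ F i, ∃ v ∈ F i, u ≠ v ∧ F (i - 1) = merge (F i) u v) ∧
      ∀ i, 1 ≤ i → i ≤ P.ncard → F i ∈ W ∧ IsParts (F i) := by
  induction h with
  | refl P =>
    subst hQ
    refine ⟨fun _ => {A}, rfl, rfl, by simp, fun i h1 h2 => ?_, fun i _ _ => ⟨rfl, hP⟩⟩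
    rw [Set.ncard_singleton] at h2
    omega
  | @step P Q W u v hu hv huv _ ih =>
    obtain ⟨F, h1, h2, h3, h4, h5⟩ := ih (hP.merge hu hv) hQ
    have hcard := ncard_merge hP hu hv huv
    -- The index is the number of parts; a merge lowers it by one, so the value at `P.ncard` is
    -- still free.
    refine ⟨Function.update F P.ncard P, by simp, ?_, by omega, fun i hi hi' => ?_,
      fun i hi hi' => ?_⟩
    · rw [Function.update_of_ne (by omega)]
      exact h2
    · rw [Function.update_of_ne (show i - 1 ≠ P.ncard by omega)]
      by_cases he : i = P.ncard
      · subst he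
        rw [Function.update_self]
        refine ⟨u, hu, v, hv, huv, ?_⟩
        rw [show P.ncard - 1 = (merge P u v).ncard by omega, h1]
      · rw [Function.update_of_ne he]
        exact h4 i hi (by omega)
    · by_cases he : i = P.ncard
      · subst he
        rw [Function.update_self]
        exact ⟨Set.mem_insert _ _, hP⟩
      · rw [Function.update_of_ne he]
        exact ⟨Set.mem_insert_of_mem _ (h5 i hi (by omega)).1, (h5 i hi (by omega)).2⟩

section

variable [Fintype V]

theorem IsDSequence.ofParts {G : SimpleGraph V} {d : ℕ} {S : ℕ → Trigraph (Set V)}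
    (hS : IsDSequence G d S) {i : ℕ} (hi : 1 ≤ i) (hi' : i ≤ Fintype.card V) :
    S i = Trigraph.ofParts G (S i).verts ∧ IsParts (S i).verts := by
  induction hi' using Nat.decreasingInduction with
  | self =>
    rw [hS.start, ofGraph_eq_ofParts]
    exact ⟨rfl, isParts_singletons _⟩
  | of_succ k hk ih =>
    obtain ⟨h1, h2⟩ := ih (by omega)
    obtain ⟨u, v, hu, hv, -, h⟩ := hS.step (k + 1) (by omega) hk
    rw [Nat.add_sub_cancel] at h
    have h3 := contract_ofParts (G := G) h2 hu hv
    rw [← h1, ← h] at h3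
    rw [h3]
    exact ⟨rfl, h2.merge hu hv⟩

theorem IsDSequence.mergePath {G : SimpleGraph V} {d : ℕ} {S : ℕ → Trigraph (Set V)}
    (hS : IsDSequence G d S) {i : ℕ} (hi : 1 ≤ i) (hi' : i ≤ Fintype.card V) :
    MergePath (S i).verts (S 1).verts {P | ∃ j, 1 ≤ j ∧ j ≤ i ∧ P = (S j).verts} := by
  induction i, hi using Nat.le_induction with
  | base =>
    have : {P | ∃ j, 1 ≤ j ∧ j ≤ 1 ∧ P = (S j).verts} = {(S 1).verts} := by
      ext P
      constructor
      · rintro ⟨j, h1, h2, rfl⟩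
        rw [le_antisymm h2 h1]
        rfl
      · rintro rfl
        exact ⟨1, le_rfl, le_rfl, rfl⟩
    rw [this]
    exact .refl _
  | succ i hi ih =>
    obtain ⟨u, v, hu, hv, huv, h⟩ := hS.step (i + 1) (by omega) hi'
    rw [Nat.add_sub_cancel] at h
    have : {P | ∃ j, 1 ≤ j ∧ j ≤ i + 1 ∧ P = (S j).verts} =
        insert (S (i + 1)).verts {P | ∃ j, 1 ≤ j ∧ j ≤ i ∧ P = (S j).verts} := by
      ext P
      constructor
      · rintro ⟨j, h1, h2, rfl⟩
        rcases h2.eq_or_lt with rfl | h2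
        · exact Or.inl rfl
        · exact Or.inr ⟨j, h1, by omega, rfl⟩
      · rintro (rfl | ⟨j, h1, h2, rfl⟩)
        · exact ⟨i + 1, by omega, le_rfl, rfl⟩
        · exact ⟨j, h1, by omega, rfl⟩
    rw [this]
    refine .step hu hv huv ?_
    have h' : merge (S (i + 1)).verts u v = (S i).verts := by rw [h]; rfl
    rw [h']
    exact ih (by omega)

/-- The sequence of vertex sets of a contraction sequence. -/
theorem IsDSequence.path {G : SimpleGraph V} {S : ℕ → Trigraph (Set V)}
    (hS : IsDSequence G 1 S) :
    ∃ W, MergePath (singletons (Set.univ : Set V)) {Set.univ} W ∧ (∀ R ∈ W, RedMatching G R) ∧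
      ∀ i, 1 ≤ i → i ≤ Fintype.card V → (S i).verts ∈ W := by
  have h := hS.mergePath hS.pos le_rfl
  have h1 : (S (Fintype.card V)).verts = singletons Set.univ := by
    rw [hS.start, ofGraph_eq_ofParts]
    rfl
  obtain ⟨x, hx⟩ := hS.last
  rw [h1, hx] at h
  have h2 := h.sUnion_eq
  rw [sUnion_singletons, Set.sUnion_singleton] at h2
  subst h2
  refine ⟨_, h, ?_, fun i h1 h2 => ⟨i, h1, h2, rfl⟩⟩
  rintro _ ⟨i, h1, h2, rfl⟩
  have := hS.red_degree i h1 h2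
  rw [(hS.ofParts h1 h2).1] at this
  exact isDTrigraph_ofParts.1 this

/-! ### Orderings, realisers and intervals -/

/-- The positions of an ordering, as integers. -/
def Ordering.pos (σ : Ordering V) (a : V) : ℤ := (σ a : ℕ)

theorem Ordering.pos_lt_pos {σ : Ordering V} {a b : V} :
    Ordering.pos σ a < Ordering.pos σ b ↔ σ a < σ b := by
  simp [Ordering.pos]

theorem Ordering.pos_injective (σ : Ordering V) : Function.Injective (Ordering.pos σ) := by
  intro a b h
  exact σ.injective (Fin.ext (Int.ofNat_inj.1 h))

theorem exists_ordering {f : V → ℤ} (hf : Function.Injective f) :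
    ∃ σ : Ordering V, ∀ a b, Ordering.pos σ a < Ordering.pos σ b ↔ f a < f b := by
  let _ : LinearOrder V := LinearOrder.lift' f hf
  let e := Fintype.orderIsoFinOfCardEq V rfl
  exact ⟨e.symm.toEquiv, fun a b => Ordering.pos_lt_pos.trans e.symm.lt_iff_lt⟩

theorem isRealiser_iff {G : SimpleGraph V} {σ τ : Ordering V} :
    IsRealiser G σ τ ↔ FnRealises G Set.univ (Ordering.pos σ) (Ordering.pos τ) := by
  have key : ∀ a b, a ≠ b → ((permGraph σ τ).Adj a b ↔
      (Ordering.pos σ a < Ordering.pos σ b ↔ Ordering.pos τ b < Ordering.pos τ a)) := by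
    intro a b hab
    have h1 : Ordering.pos σ a ≠ Ordering.pos σ b := (Ordering.pos_injective σ).ne hab
    have h2 : Ordering.pos τ a ≠ Ordering.pos τ b := (Ordering.pos_injective τ).ne hab
    simp only [permGraph, ← Ordering.pos_lt_pos]
    omega
  constructor
  · rintro rfl
    exact ⟨(Ordering.pos_injective σ).injOn, (Ordering.pos_injective τ).injOn,
      fun a _ b _ hab => key a b hab⟩
  · intro h
    ext a b
    rcases eq_or_ne a b with rfl | hab
    · simp
    · rw [h.adj_iff a trivial b trivial hab, key a b hab]

theorem isInterval_of_convexIn {σ : Ordering V} {z : Set V} (hz : z.Nonempty)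
    (h : ConvexIn (Ordering.pos σ) Set.univ z) : IsInterval σ z := by
  obtain ⟨a, ha, hmin⟩ := Set.exists_min_image z σ z.toFinite hz
  obtain ⟨c, hc, hmax⟩ := Set.exists_max_image z σ z.toFinite hz
  refine ⟨σ a, σ c, Set.ext fun b => ⟨fun hb => ⟨hmin b hb, hmax b hb⟩, ?_⟩⟩
  rintro ⟨h1, h2⟩
  rcases h1.eq_or_lt with e | h1
  · exact σ.injective e ▸ ha
  rcases h2.eq_or_lt with e | h2
  · exact σ.injective e ▸ hc
  exact h a ha c hc b trivial (Ordering.pos_lt_pos.2 h1) (Ordering.pos_lt_pos.2 h2)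

theorem IsDSequence.isAdapted {G : SimpleGraph V} {d : ℕ} {S : ℕ → Trigraph (Set V)}
    (hS : IsDSequence G d S) {σ τ : Ordering V}
    (h : ∀ i, 1 ≤ i → i ≤ Fintype.card V →
      AdaptedTo G Set.univ (Ordering.pos σ) (Ordering.pos τ) (S i).verts) : IsAdapted S σ τ := by
  constructor
  · intro i h1 h2 x hx
    have hne := (hS.ofParts h1 h2).2.nonempty x hx
    exact ((h i h1 h2).vertex x hx).imp (isInterval_of_convexIn hne) (isInterval_of_convexIn hne)
  · intro i h1 h2 x y hxy
    obtain ⟨e, hp⟩ := hS.ofParts h1 h2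
    rw [e] at hxy
    obtain ⟨hx, hy, hne, hm⟩ := hxy
    have nx := hp.nonempty x hx
    have ny := hp.nonempty y hy
    have nu : (x ∪ y).Nonempty := nx.mono Set.subset_union_left
    exact ((h i h1 h2).red x hx y hy hne hm).imp
      (fun k => ⟨isInterval_of_convexIn nu k.1, isInterval_of_convexIn nx k.2.1,
        isInterval_of_convexIn ny k.2.2⟩)
      fun k => ⟨isInterval_of_convexIn nu k.1, isInterval_of_convexIn nx k.2.1,
        isInterval_of_convexIn ny k.2.2⟩

/-! ### Representatives and following a realiser -/

theorem underlying_ofParts {G : SimpleGraph V} {P : Set (Set V)} {x y : Set V} :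
    (Trigraph.ofParts G P).underlying.Adj x y ↔
      x ∈ P ∧ y ∈ P ∧ x ≠ y ∧ ((∀ a ∈ x, ∀ b ∈ y, G.Adj a b) ∨ Mixed G x y) := by
  change (_ ∧ _ ∧ _ ∧ _) ∨ (_ ∧ _ ∧ _ ∧ _) ↔ _
  tauto

/-- Pairs that are not mixed impose no condition on the representatives. A mixed pair needs an edge
between its two representatives, and these demands are independent because the mixed pairs form a
matching. -/
theorem exists_isInducedCopy {G : SimpleGraph V} {P : Set (Set V)} (hP : IsParts P)
    (hr : RedMatching G P) [Nonempty V] : ∃ r, IsInducedCopy G (Trigraph.ofParts G P) r := by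
  classical
  have hpick : ∀ x y : Set V, ∃ p : V × V, Mixed G x y → p.1 ∈ x ∧ p.2 ∈ y ∧ G.Adj p.1 p.2 := by
    intro x y
    by_cases h : Mixed G x y
    · obtain ⟨⟨a, ha, b, hb, hab⟩, -⟩ := h
      exact ⟨(a, b), fun _ => ⟨ha, hb, hab⟩⟩
    · exact ⟨(Classical.arbitrary V, Classical.arbitrary V), fun h' => (h h').elim⟩
  choose pick hpick using hpick
  -- The well-ordering decides which of `pick x y` and `pick y x` serves the unordered pair, so that
  -- both ends use the same edge.
  have hrep : ∀ x, ∃ a, (x ∈ P → a ∈ x) ∧ ∀ y, x ∈ P → y ∈ P → x ≠ y → Mixed G x y →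
      a = if WellOrderingRel x y then (pick x y).1 else (pick y x).2 := by
    intro x
    by_cases h : ∃ y, x ∈ P ∧ y ∈ P ∧ x ≠ y ∧ Mixed G x y
    · obtain ⟨y, hx, hy, hxy, hm⟩ := h
      refine ⟨if WellOrderingRel x y then (pick x y).1 else (pick y x).2, fun _ => ?_,
        fun z _ hz hxz hm' => ?_⟩
      · split_ifs
        · exact (hpick x y hm).1
        · exact (hpick y x hm.symm).2.1
      · rw [hr x hx y hy z hz hxy hxz hm hm']
    · by_cases hx : x ∈ P
      · obtain ⟨a, ha⟩ := hP.nonempty x hx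
        exact ⟨a, fun _ => ha, fun y h1 h2 h3 h4 => (h ⟨y, h1, h2, h3, h4⟩).elim⟩
      · exact ⟨Classical.arbitrary V, fun h => (hx h).elim, fun y h => (hx h).elim⟩
  choose r hr1 hr2 using hrep
  refine ⟨r, fun x hx => hr1 x hx, fun x hx y hy => ?_⟩
  change x ∈ P at hx
  change y ∈ P at hy
  rw [underlying_ofParts]
  rcases eq_or_ne x y with rfl | hxy
  · simp
  by_cases hm : Mixed G x y
  · refine iff_of_true ⟨hx, hy, hxy, Or.inr hm⟩ ?_
    rw [hr2 x y hx hy hxy hm, hr2 y x hy hx hxy.symm hm.symm]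
    rcases trichotomous_of WellOrderingRel x y with h | h | h
    · rw [if_pos h, if_neg (asymm_of WellOrderingRel h)]
      exact (hpick x y hm).2.2
    · exact (hxy h).elim
    · rw [if_pos h, if_neg (asymm_of WellOrderingRel h)]
      exact (hpick y x hm.symm).2.2.symm
  · rcases not_mixed_iff.1 hm with h | h
    · exact iff_of_true ⟨hx, hy, hxy, Or.inl h⟩ (h _ (hr1 x hx) _ (hr1 y hy))
    · refine iff_of_false ?_ (h _ (hr1 x hx) _ (hr1 y hy))
      rintro ⟨-, -, -, h' | h'⟩
      · exact h _ (hr1 x hx) _ (hr1 y hy) (h' _ (hr1 x hx) _ (hr1 y hy))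
      · exact hm h'

/-- By disjointness of the parts, a representative lying in `x ∪ y` can only be that of `x` or of
`y`; the bounds `i` and `j` of the interval serve unchanged. -/
theorem isInducedInterval_pair {σ : Ordering V} {H : Trigraph (Set V)} (hH : IsParts H.verts)
    {r : Set V → V} (hr : ∀ x ∈ H.verts, r x ∈ x) {x y : Set V} (hx : x ∈ H.verts)
    (hy : y ∈ H.verts) (h : IsInterval σ (x ∪ y)) : IsInducedInterval σ H r {x, y} := by
  obtain ⟨i, j, hij⟩ := h
  refine ⟨i, j, Set.ext fun w => ?_⟩
  have key : ∀ w, r w ∈ x ∪ y ↔ i ≤ σ (r w) ∧ σ (r w) ≤ j := fun w => by rw [hij]; rfl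
  constructor
  · rintro (rfl | rfl)
    · exact ⟨hx, (key _).1 (Or.inl (hr _ hx))⟩
    · exact ⟨hy, (key _).1 (Or.inr (hr _ hy))⟩
  · rintro ⟨hw, h⟩
    rcases (key w).2 h with h | h
    · exact Or.inl (hH.eq_of_mem hw hx (hr w hw) h)
    · exact Or.inr (hH.eq_of_mem hw hy (hr w hw) h)

/-- A sequence follows every realiser to which it is adapted. -/
theorem IsDSequence.follows {G : SimpleGraph V} {S : ℕ → Trigraph (Set V)}
    (hS : IsDSequence G 1 S) {σ τ : Ordering V} (h : IsAdapted S σ τ) : Follows G S σ τ := by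
  intro i h1 h2
  obtain ⟨e, hp⟩ := hS.ofParts h1.le h2
  have hred := hS.red_degree i h1.le h2
  rw [e, isDTrigraph_ofParts] at hred
  have : Nonempty V := Fintype.card_pos_iff.1 hS.pos
  refine ⟨?_, fun r hr => ⟨fun u v huv => ?_, fun x y hxy => ?_⟩⟩
  · rw [e]
    exact exists_isInducedCopy hp hred
  · obtain ⟨hu, hv, -, huv⟩ := huv
    -- The interval property is applied at index `i - 1`, where the contracted pair has become a
    -- single vertex.
    have hmem : u ∪ v ∈ (S (i - 1)).verts := by
      rw [huv]
      exact Set.mem_insert _ _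
    exact (h.vertex (i - 1) (by omega) (by omega) _ hmem).imp
      (isInducedInterval_pair hp hr.1 hu hv) (isInducedInterval_pair hp hr.1 hu hv)
  · have hx := (S i).red_mem hxy
    have hy := (S i).red_mem hxy.symm
    exact (h.red i h1.le h2 x y hxy).imp (fun k => isInducedInterval_pair hp hr.1 hx hy k.1)
      fun k => isInducedInterval_pair hp hr.1 hx hy k.1

end

end TwinWidthOne

theorem mainTheorem3 {V : Type*} [Fintype V] (G : SimpleGraph V)
    (S : ℕ → TwinWidthOne.Trigraph (Set V)) (hS : TwinWidthOne.IsDSequence G 1 S) :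
    ((∃ σ τ : TwinWidthOne.Ordering V,
        TwinWidthOne.IsRealiser G σ τ ∧ TwinWidthOne.IsAdapted S σ τ) ∧
      ∀ σ τ : TwinWidthOne.Ordering V,
        TwinWidthOne.IsRealiser G σ τ → TwinWidthOne.IsAdapted S σ τ →
          TwinWidthOne.Follows G S σ τ) ∧
    ∀ σ' τ' : TwinWidthOne.Ordering V, TwinWidthOne.IsRealiser G σ' τ' →
      ∃ S' : ℕ → TwinWidthOne.Trigraph (Set V),
        TwinWidthOne.IsDSequence G 1 S' ∧ TwinWidthOne.Follows G S' σ' τ' := by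
  open TwinWidthOne in
  obtain ⟨W, hW, hWr, hSW⟩ := hS.path
  refine ⟨⟨?_, fun σ τ _ h => hS.follows h⟩, fun σ' τ' h => ?_⟩
  · obtain ⟨f, g, hfg, had⟩ := hW.exists_adapted hWr
    obtain ⟨σ, hσ⟩ := exists_ordering (Set.injOn_univ.1 hfg.injOn_left)
    obtain ⟨τ, hτ⟩ := exists_ordering (Set.injOn_univ.1 hfg.injOn_right)
    -- Convexity depends only on the relative order, so renumbering positions does not affect
    -- adaptedness.
    have cσ : ∀ z : Set V, ConvexIn (Ordering.pos σ) Set.univ z ↔ ConvexIn f Set.univ z :=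
      fun z => convexIn_congr (Set.subset_univ z) fun a _ b _ _ => hσ a b
    have cτ : ∀ z : Set V, ConvexIn (Ordering.pos τ) Set.univ z ↔ ConvexIn g Set.univ z :=
      fun z => convexIn_congr (Set.subset_univ z) fun a _ b _ _ => hτ a b
    refine ⟨σ, τ, isRealiser_iff.2 ⟨(Ordering.pos_injective σ).injOn,
      (Ordering.pos_injective τ).injOn, fun a ha b hb hab => ?_⟩,
      hS.isAdapted fun i h1 h2 => ⟨?_, ?_⟩⟩
    · rw [hσ, hτ]
      exact hfg.adj_iff a ha b hb hab
    · simp only [cσ, cτ]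
      exact (had _ (hSW i h1 h2)).vertex
    · simp only [cσ, cτ]
      exact (had _ (hSW i h1 h2)).red
  · have : Nonempty V := Fintype.card_pos_iff.1 hS.pos
    -- The given sequence `S` enters only through contractibility of the whole vertex set; the new
    -- chain may be a different one.
    have hc := FnRealises.exists_path (G := G) (f := Ordering.pos σ') (g := Ordering.pos τ')
      Finset.univ Finset.univ_nonempty (by rw [Finset.coe_univ]; exact isRealiser_iff.1 h)
      (by rw [Finset.coe_univ]; exact ⟨W, hW, hWr⟩)
    rw [Finset.coe_univ] at hc
    obtain ⟨W', hW', hr⟩ := hc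
    obtain ⟨F, h1, h2, h3, h4, h5⟩ := hW'.exists_sequence (isParts_singletons _) rfl
    have hcard : (singletons (Set.univ : Set V)).ncard = Fintype.card V := by
      rw [singletons, Set.ncard_image_of_injective _ Set.singleton_injective, Set.ncard_univ,
        Nat.card_eq_fintype_card]
    rw [hcard] at h1 h3 h4 h5
    have hS' : IsDSequence G 1 fun i => Trigraph.ofParts G (F i) := by
      refine ⟨h3, ?_, ⟨Set.univ, h2⟩, fun i hi hi' => ?_, fun i hi hi' => ?_⟩
      · rw [h1, ofGraph_eq_ofParts]
      · obtain ⟨u, hu, v, hv, huv, e⟩ := h4 i hi hi'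
        refine ⟨u, v, hu, hv, huv, ?_⟩
        rw [e, contract_ofParts (h5 i hi.le hi').2 hu hv]
      · exact isDTrigraph_ofParts.2 (hr _ (h5 i hi hi').1).1
    exact ⟨_, hS', hS'.follows (hS'.isAdapted fun i hi hi' => (hr _ (h5 i hi hi').1).2)⟩
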